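/- Let $\mathbb K$ be a field, let $G$ be a tree on the vertex set $[n+1]=\{1,\dots,n+1\}$, and let $S=\mathbb K[x_1,\dots,x_{n+1},y_1,\dots,y_{n+1}]$. For an edge $e=\{i,j\}$ of $G$ with $i<j$ let $f_e=x_iy_j-x_jy_i\in S$. Root $G$ at a pendant vertex $x_0$ (a vertex of degree one), and let the level of an edge be the distance from $x_0$ to the endpoint of that edge that is farther from $x_0$. Let $e_1,\dots,e_n$ be the edges of $G$, each listed once, ordered so that their levels are non-decreasing (edges of the same level may be arranged in any order). Then $f_{e_1},\dots,f_{e_n}$ is a sequence of linear type, that is, for every $1\le i\le n$ the ideal $(f_{e_1},\dots,f_{e_i})$ is of linear type. Here, for a sequence $z_1,\dots,z_m$ of elements of a commutative ring $A$, a relation is a form of positive degree in $A[X_1,\dots,X_m]$ (the elements of $A$ having degree $0$ and each $X_k$ degree $1$) that vanishes at $(z_1,\dots,z_m)$; $\Lambda_j$ is the ideal generated by the relations of degree at most $j$; the relation type of the ideal $(z_1,\dots,z_m)$ is the least positive integer $r$ with $\Lambda_r=\bigcup_{j\ge r}\Lambda_j$; and the ideal $(z_1,\dots,z_m)$ is of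 linear type if its relation type is $1$. -/

import Mathlib

namespace BinomialEdge

section LinearType

variable {A : Type*} [CommRing A] {n : ℕ}

/-- A relation of degree `d` on the sequence `z`: a form of positive degree `d` in
`A[X_1, …, X_n]` that vanishes when evaluated at `z`. -/
def IsRelation (z : Fin n → A) (d : ℕ) (F : MvPolynomial (Fin n) A) : Prop :=
  0 < d ∧ F.IsHomogeneous d ∧ MvPolynomial.eval z F = 0

/-- The ideal `Λ_j` generated by the relations on `z` of degree at most `j`. -/
noncomputable def relationIdeal (z : Fin n → A) (j : ℕ) : Ideal (MvPolynomial (Fin n) A) :=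
  Ideal.span {F | ∃ d ≤ j, IsRelation z d F}

/-- The relation type of the ideal generated by `z`: the least positive `r` with
`Λ_r = ⋃_{j ≥ r} Λ_j` (and `0` if there is no such `r`). -/
noncomputable def relationType (z : Fin n → A) : ℕ :=
  sInf {r : ℕ | 0 < r ∧
    (relationIdeal z r : Set (MvPolynomial (Fin n) A)) = ⋃ j ≥ r, relationIdeal z j}

/-- The ideal `(z_1, …, z_n)` is of linear type: its relation type is `1`. -/
def IsLinearType (z : Fin n → A) : Prop :=
  relationType z = 1

/-- A sequence of linear type: each ideal `(z_1, …, z_i)`, `1 ≤ i ≤ n`, is of linear type. -/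
def IsSequenceOfLinearType (z : Fin n → A) : Prop :=
  ∀ (i : ℕ) (hi : i ≤ n), 1 ≤ i → IsLinearType fun k : Fin i => z (Fin.castLE hi k)

end LinearType

/-- The edge binomial `x_i y_j - x_j y_i` of an edge `{i, j}` with `i < j`, in
`K[x_v, y_v : v ∈ V]`, where `x_v = X (Sum.inl v)` and `y_v = X (Sum.inr v)`. -/
noncomputable def edgeBinomial (K : Type*) [Field K] {V : Type*} [LinearOrder V] (e : Sym2 V) :
    MvPolynomial (V ⊕ V) K :=
  MvPolynomial.X (Sum.inl e.inf) * MvPolynomial.X (Sum.inr e.sup) -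
    MvPolynomial.X (Sum.inl e.sup) * MvPolynomial.X (Sum.inr e.inf)

/-- A pendant vertex: a vertex of degree one. -/
def IsPendant {V : Type*} (G : SimpleGraph V) (v : V) : Prop :=
  ∃! u, G.Adj v u

/-- The level of an edge in the tree `G` rooted at `r`: the distance from `r` to the endpoint
of the edge that is farther from `r`. -/
noncomputable def edgeLevel {V : Type*} (G : SimpleGraph V) (r : V) (e : Sym2 V) : ℕ :=
  (e.map (G.dist r)).sup

end BinomialEdge

/-!
The edge binomials of *every* forest generate an ideal of linear type
(`BinomialEdge.isLinearType_edgeBinomial`). This gives the theorem at once, because the first `i`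
edges of a tree, in any order, form a forest.

Write `x_u y_v - x_v y_u` as a minor of a generic matrix with two rows whose columns are indexed by
the vertices. If `a`, `b`, `c` are neighbours of `w`, there is a linear relation among the minors
of the edges `wa`, `wb`, `wc`, obtained by expanding a three-rowed determinant (`plucker`). Adjoin
a symbol for each edge and a Rees variable `X`, and let `reesIdeal G` be generated by the elements
`minor - X * symbol` of the edges and by these linear relations. A relation of degree `d` among the
edge binomials lies in `reesIdeal G` after multiplication by `X ^ d`. Hence, if `X` is regular
modulo `reesIdeal G`, the relation itself lies in this ideal, and it remains to remove `X`:
substituting the value of a generator for one variable of each monomial maps linear relations to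
linear relations (`contraction_mem`), so a consequence of the linear relations and of `f_k = X *
X_k` is a consequence of the linear relations alone (`mem_relationIdeal_of_C_mem`).

That `X` is regular is shown by induction on the forest (`regularMod_of_isAcyclic`), simultaneously
with the regularity of `x_p` modulo `markedIdeal G p`, which is the ideal `gradedIdeal G` obtained
by setting `X = 0` together with the minors of the neighbours of `p`. Removing an edge `pa` leaves
the part `G₁` on the side of `p` and the part `G₂` on the side of `a`, whose ideals involve
disjoint sets of variables, so that everything modulo one part is flat over everything modulo the
other (`exists_syzygy_of_disjoint`).

* For the Rees ideal, all new generators are linear in the symbol of `pa`. The substitution of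
  `minor a p / X` for this symbol has a kernel generated by these relations and those of `G₁ ⊔ G₂`,
  provided that the minor is regular modulo the ideal of their leading coefficients and of the
  relations of `G₁ ⊔ G₂` (`regularMod_linearIdeal_of_root`). Modulo `X` that ideal is `markedIdeal
  G₁ p ⊔ markedIdeal G₂ a`, and after a degeneration the minor has the leading term `y_p x_a`,
  which is regular by induction (`EdgeSplit.regularMod_minor`).
* For `markedIdeal G p`, the new generators are the minors of `a` with `p` and its neighbours, and
  the linear relations at `a` that involve `p`. Both families are linear in a suitable grading, and
  one can pass to their leading coefficients once the syzygies of these are syzygies of the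
  trailing coefficients (`regularMod_linearIdeal`). For the first family this holds because the
  columns of `p` and its neighbours are proportional. For the second family the leading
  coefficients are the minors of the neighbours of `a`, and their syzygies modulo `gradedIdeal G₂`
  are described by the regularity of `X` modulo `reesIdeal G₂` (`hasColumnSyzygies_of_regularMod`).
  The first family also needs the regularity of `x_p` after the variables `y_b` of the closed
  neighbourhood of `p` have been set to zero, which is carried along in the induction.
-/

namespace BinomialEdge

/-! ### Regular elements and ideals generated by linear polynomials -/

section Regular

open Polynomial

variable {R : Type*} [CommRing R]

/-- `x` is a nonzerodivisor modulo the ideal `I`; the ideal `I` need not be proper. -/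
def RegularMod (I : Ideal R) (x : R) : Prop :=
  ∀ q, x * q ∈ I → q ∈ I

theorem RegularMod.mul {I : Ideal R} {x y : R} (hx : RegularMod I x) (hy : RegularMod I y) :
    RegularMod I (x * y) := fun q hq => hy q (hx _ (by rwa [← mul_assoc]))

theorem RegularMod.pow {I : Ideal R} {x : R} (hx : RegularMod I x) (n : ℕ) :
    RegularMod I (x ^ n) := by
  induction n with
  | zero => intro q hq; simpa using hq
  | succ n ih => rw [pow_succ]; exact ih.mul hx

variable {ι : Type*}

/-- The ideal of `R[X]` generated by `q` and by the linear polynomials `d i * X + e i`. -/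
noncomputable def linearIdeal (q : Ideal R) (d e : ι → R) : Ideal R[X] :=
  q.map C ⊔ Ideal.span (Set.range fun i => C (d i) * X + C (e i))

/-- A ring homomorphism `δ : R → R[X]` with a section `X ↦ s` lets one prove regularity modulo
`q + (r i)` in `R[X]`, where the elements `δ (r i)` are linear in `X`. -/
theorem regularMod_of_linearIdeal {q : Ideal R} {x : R} {d e r : ι → R} (δ : R →+* R[X]) (s : R)
    (hs : ∀ a, (δ a).eval s = a) (hq : ∀ a ∈ q, δ a ∈ q.map C) (hx : δ x = C x)
    (hr : ∀ i, δ (r i) = C (d i) * X + C (e i))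
    (h : RegularMod (linearIdeal q d e) (C x)) :
    RegularMod (q ⊔ Ideal.span (Set.range r)) x := by
  intro a ha
  have h1 : (q ⊔ Ideal.span (Set.range r)).map δ ≤ linearIdeal q d e := by
    rw [Ideal.map_le_iff_le_comap, sup_le_iff, Ideal.span_le]
    refine ⟨fun b hb => Ideal.mem_sup_left (hq b hb), ?_⟩
    rintro _ ⟨i, rfl⟩
    refine Ideal.mem_sup_right (Ideal.subset_span ⟨i, (hr i).symm⟩)
  have h2 : δ a ∈ linearIdeal q d e := by
    refine h _ ?_
    rw [← hx, ← map_mul]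
    exact h1 (Ideal.mem_map_of_mem _ ha)
  have h3 : (linearIdeal q d e).map (evalRingHom s) ≤ q ⊔ Ideal.span (Set.range r) := by
    rw [linearIdeal, Ideal.map_sup, Ideal.map_map, Ideal.map_span]
    refine sup_le_sup ?_ ?_
    · rw [Ideal.map_le_iff_le_comap]
      intro b hb
      simpa using hb
    · rw [Ideal.span_le]
      rintro _ ⟨_, ⟨i, rfl⟩, rfl⟩
      refine Ideal.subset_span ⟨i, ?_⟩
      rw [← hs (r i), hr i]; rfl
  have := h3 (Ideal.mem_map_of_mem (evalRingHom s) h2)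
  rwa [coe_evalRingHom, hs] at this

variable [Fintype ι]

theorem exists_sum_of_mem_sup_span {I : Ideal R} {v : ι → R} {r : R}
    (h : r ∈ I ⊔ Ideal.span (Set.range v)) : ∃ c : ι → R, r - ∑ i, c i * v i ∈ I := by
  obtain ⟨a, ha, b, hb, rfl⟩ := Submodule.mem_sup.mp h
  obtain ⟨c, rfl⟩ := Ideal.mem_span_range_iff_exists_fun.mp hb
  exact ⟨c, by simpa using ha⟩

theorem mem_sup_span_of_sum {I : Ideal R} {v : ι → R} {r : R} (c : ι → R)
    (h : r - ∑ i, c i * v i ∈ I) : r ∈ I ⊔ Ideal.span (Set.range v) := by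
  have h2 : ∑ i, c i * v i ∈ Ideal.span (Set.range v) :=
    Ideal.mem_span_range_iff_exists_fun.mpr ⟨c, rfl⟩
  have := Ideal.add_mem _ (Ideal.mem_sup_left (T := Ideal.span (Set.range v)) h)
    (Ideal.mem_sup_right (S := I) h2)
  simpa using this

theorem coeff_sum_linear (g : ι → R[X]) (d e : ι → R) (n : ℕ) :
    (∑ i, g i * (C (d i) * X + C (e i))).coeff (n + 1) =
      ∑ i, (g i).coeff n * d i + ∑ i, (g i).coeff (n + 1) * e i := by
  rw [finsetSum_coeff, ← Finset.sum_add_distrib]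
  refine Finset.sum_congr rfl fun i _ => ?_
  rw [mul_add, coeff_add, ← mul_assoc, coeff_mul_X, coeff_mul_C, coeff_mul_C]

/-- Cancelling a combination of the leading coefficients `d i` leaves a combination of the `e i`. -/
theorem sum_monomial_linear_mem {q : Ideal R} {d e : ι → R} (n : ℕ) (g : ι → R)
    (hd : ∑ i, g i * d i ∈ q) (he : ∑ i, g i * e i ∈ q) :
    ∑ i, C (g i) * X ^ n * (C (d i) * X + C (e i)) ∈ q.map (C : R →+* R[X]) := by
  have : ∑ i, C (g i) * X ^ n * (C (d i) * X + C (e i)) =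
      C (∑ i, g i * d i) * X ^ (n + 1) + C (∑ i, g i * e i) * X ^ n := by
    simp only [map_sum, Finset.sum_mul, ← Finset.sum_add_distrib, C_mul]
    exact Finset.sum_congr rfl fun i _ => by ring
  rw [this]
  exact Ideal.add_mem _ (Ideal.mul_mem_right _ _ (Ideal.mem_map_of_mem _ hd))
    (Ideal.mul_mem_right _ _ (Ideal.mem_map_of_mem _ he))

theorem coeff_sub_C_mul_X_pow_eq_zero {g : R[X]} {n : ℕ} (hg : ∀ k, n + 1 ≤ k → g.coeff k = 0) :
    ∀ k, n ≤ k → (g - C (g.coeff n) * X ^ n).coeff k = 0 := by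
  intro k hk
  rw [coeff_sub, coeff_C_mul_X_pow]
  rcases eq_or_lt_of_le hk with rfl | hlt
  · simp
  · rw [if_neg hlt.ne', hg k hlt, sub_zero]

theorem exists_coeff_bound (g : ι → R[X]) : ∃ n, ∀ i k, n ≤ k → (g i).coeff k = 0 := by
  refine ⟨(Finset.univ.sup fun i => (g i).natDegree) + 1, fun i k hk => ?_⟩
  refine coeff_eq_zero_of_natDegree_lt (lt_of_lt_of_le ?_ hk)
  exact Nat.lt_succ_of_le (Finset.le_sup (f := fun i => (g i).natDegree) (Finset.mem_univ i))

/-- If every syzygy modulo `q` of the leading coefficients `d i` is one of the `e i`, then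
regularity modulo `q` and modulo `q + (d i)` passes to `q + (d i * X + e i)`. -/
theorem regularMod_linearIdeal {q : Ideal R} {x : R} {d e : ι → R} (hxq : RegularMod q x)
    (hxd : RegularMod (q ⊔ Ideal.span (Set.range d)) x)
    (hsyz : ∀ g : ι → R, ∑ i, g i * d i ∈ q → ∑ i, g i * e i ∈ q) :
    RegularMod (linearIdeal q d e) (C x) := by
  -- Induct on a bound `n` for the degrees of the multipliers `g i`: their top coefficients are
  -- corrected by means of the hypothesis on `d`, and `hsyz` keeps the correction inside the ideal.
  suffices H : ∀ n (h : R[X]) (g : ι → R[X]), (∀ i k, n ≤ k → (g i).coeff k = 0) →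
      C x * h - ∑ i, g i * (C (d i) * X + C (e i)) ∈ q.map C → h ∈ linearIdeal q d e by
    intro h hh
    obtain ⟨g, hg⟩ := exists_sum_of_mem_sup_span hh
    obtain ⟨n, hn⟩ := exists_coeff_bound g
    exact H n h g hn hg
  intro n
  induction n with
  | zero =>
    intro h g hg hm
    have : ∀ i, g i = 0 := fun i => Polynomial.ext fun k => by simpa using hg i k (Nat.zero_le _)
    simp only [this, zero_mul, Finset.sum_const_zero, sub_zero] at hm
    refine Ideal.mem_sup_left (Ideal.mem_map_C_iff.mpr fun k => hxq _ ?_)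
    simpa using Ideal.mem_map_C_iff.mp hm k
  | succ n ih =>
    intro h g hg hm
    have htop := Ideal.mem_map_C_iff.mp hm (n + 1)
    rw [coeff_sub, coeff_C_mul, coeff_sum_linear] at htop
    simp only [fun i => hg i (n + 1) le_rfl, zero_mul, Finset.sum_const_zero, add_zero] at htop
    obtain ⟨c, hc⟩ := exists_sum_of_mem_sup_span (hxd _ (mem_sup_span_of_sum _ htop))
    have hd : ∑ i, ((g i).coeff n - x * c i) * d i ∈ q := by
      have := Ideal.sub_mem _ (Ideal.mul_mem_left _ x hc) htop
      convert this using 1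
      simp only [sub_mul, Finset.sum_sub_distrib, mul_sub, Finset.mul_sum, mul_assoc]
      ring
    have hde := sum_monomial_linear_mem n _ hd (hsyz _ hd)
    have key := ih (h - ∑ i, C (c i) * X ^ n * (C (d i) * X + C (e i)))
      (fun i => g i - C ((g i).coeff n) * X ^ n)
      (fun i => coeff_sub_C_mul_X_pow_eq_zero (hg i)) (by
        have := Ideal.add_mem _ hm hde
        convert this using 1
        simp only [sub_mul, Finset.sum_sub_distrib, mul_sub, Finset.mul_sum, C_sub, C_mul,
          mul_assoc]
        ring)
    have hmem : ∑ i, C (c i) * X ^ n * (C (d i) * X + C (e i)) ∈ linearIdeal q d e :=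
      Ideal.sum_mem _ fun i _ => Ideal.mul_mem_left _ _
        (Ideal.mem_sup_right (Ideal.subset_span ⟨i, rfl⟩))
    simpa using Ideal.add_mem _ key hmem

/-- If combinations of the leading coefficients `d i` meet `q'` only inside `q`, then so do
combinations of the elements `r i`. -/
theorem sum_mem_of_sum_mem {q q' : Ideal R} {d e r : ι → R} (δ : R →+* R[X]) (s : R)
    (hs : ∀ a, (δ a).eval s = a) (hq : ∀ a ∈ q', δ a ∈ q'.map C)
    (hr : ∀ i, δ (r i) = C (d i) * X + C (e i)) (hqq : q ≤ q')
    (hd : ∀ g : ι → R, ∑ i, g i * d i ∈ q' → ∑ i, g i * d i ∈ q)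
    (hsyz : ∀ g : ι → R, ∑ i, g i * d i ∈ q → ∑ i, g i * e i ∈ q)
    {g : ι → R} (hg : ∑ i, g i * r i ∈ q') : ∑ i, g i * r i ∈ q := by
  have H : ∀ n (g : ι → R[X]), (∀ i k, n ≤ k → (g i).coeff k = 0) →
      ∑ i, g i * (C (d i) * X + C (e i)) ∈ q'.map C →
      ∑ i, g i * (C (d i) * X + C (e i)) ∈ q.map C := by
    intro n
    induction n with
    | zero =>
      intro g hg _
      have : ∀ i, g i = 0 := fun i => Polynomial.ext fun k => by simpa using hg i k (Nat.zero_le _)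
      simp [this]
    | succ n ih =>
      intro g hg hm
      have htop := Ideal.mem_map_C_iff.mp hm (n + 1)
      rw [coeff_sum_linear] at htop
      simp only [fun i => hg i (n + 1) le_rfl, zero_mul, Finset.sum_const_zero, add_zero] at htop
      have hde := sum_monomial_linear_mem n _ (hd _ htop) (hsyz _ (hd _ htop))
      have key := ih (fun i => g i - C ((g i).coeff n) * X ^ n)
        (fun i => coeff_sub_C_mul_X_pow_eq_zero (hg i)) (by
          have := Ideal.sub_mem _ hm (Ideal.map_mono hqq hde)
          simpa only [sub_mul, Finset.sum_sub_distrib] using this)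
      have := Ideal.add_mem _ key hde
      simpa only [sub_mul, Finset.sum_sub_distrib, sub_add_cancel] using this
  obtain ⟨n, hn⟩ := exists_coeff_bound fun i => δ (g i)
  have h1 : ∑ i, δ (g i) * (C (d i) * X + C (e i)) ∈ q.map C := by
    refine H n _ hn ?_
    simpa only [map_sum, map_mul, hr] using hq _ hg
  have h2 := Ideal.mem_map_of_mem (evalRingHom s) h1
  rw [Ideal.map_map] at h2
  have h3 : q.map ((evalRingHom s).comp C) ≤ q := by
    rw [Ideal.map_le_iff_le_comap]; intro b hb; simpa using hb
  have h4 := h3 h2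
  rw [map_sum] at h4
  convert h4 using 1
  refine Finset.sum_congr rfl fun i _ => ?_
  rw [map_mul, coe_evalRingHom, hs, ← hr, hs]

/-- An element is regular if its leading coefficient under `δ` is. -/
theorem regularMod_of_leading {q : Ideal R} {f d e : R} (δ : R →+* R[X]) (s : R)
    (hs : ∀ a, (δ a).eval s = a) (hq : ∀ a ∈ q, δ a ∈ q.map C)
    (hf : δ f = C d * X + C e) (hd : RegularMod q d) : RegularMod q f := by
  intro a ha
  have H : ∀ n (g : R[X]), (∀ k, n ≤ k → g.coeff k = 0) →
      (C d * X + C e) * g ∈ q.map C → g ∈ q.map C := by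
    intro n
    induction n with
    | zero =>
      intro g hg _
      have : g = 0 := Polynomial.ext fun k => by simpa using hg k (Nat.zero_le _)
      simp [this]
    | succ n ih =>
      intro g hg hm
      have htop := Ideal.mem_map_C_iff.mp hm (n + 1)
      rw [add_mul, coeff_add, mul_assoc, coeff_C_mul, coeff_C_mul, coeff_X_mul,
        hg _ le_rfl, mul_zero, add_zero] at htop
      have hmono : C (g.coeff n) * X ^ n ∈ q.map (C : R →+* R[X]) :=
        Ideal.mul_mem_right _ _ (Ideal.mem_map_of_mem _ (hd _ htop))
      have key := ih (g - C (g.coeff n) * X ^ n) (coeff_sub_C_mul_X_pow_eq_zero hg) (by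
        rw [mul_sub]
        exact Ideal.sub_mem _ hm (Ideal.mul_mem_left _ _ hmono))
      simpa using Ideal.add_mem _ key hmono
  have h1 : δ a ∈ q.map C := by
    refine H ((δ a).natDegree + 1) _ (fun k hk => coeff_eq_zero_of_natDegree_lt hk) ?_
    rw [← hf, ← map_mul]
    exact hq _ ha
  have h2 := Ideal.mem_map_of_mem (evalRingHom s) h1
  rw [Ideal.map_map] at h2
  have h3 : q.map ((evalRingHom s).comp C) ≤ q := by
    rw [Ideal.map_le_iff_le_comap]; intro b hb; simpa using hb
  simpa [hs] using h3 h2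

/-- Substituting `X ↦ f / z` in the localization of `R ⧸ q` at `z` has kernel generated by `q` and
the linear polynomials `d i * X + e i`, provided that `f` is regular modulo `q` and their leading
coefficients, among whose combinations is `z`. As `z` is a unit in the localization, it is regular
modulo that kernel. -/
theorem regularMod_linearIdeal_of_root {q : Ideal R} {z f : R} {d e : ι → R}
    (hz : RegularMod q z) (hroot : ∀ i, z * e i + d i * f ∈ q)
    (hzd : z ∈ Ideal.span (Set.range d))
    (hf : RegularMod (q ⊔ Ideal.span (Set.range d)) f) :
    RegularMod (linearIdeal q d e) (C z) := by
  let L := Localization.Away (Ideal.Quotient.mk q z)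
  let φ : R →+* L := (algebraMap (R ⧸ q) L).comp (Ideal.Quotient.mk q)
  have hφ0 : ∀ a ∈ q, φ a = 0 := fun a ha => by
    simp [φ, Ideal.Quotient.eq_zero_iff_mem.mpr ha]
  have hφ : ∀ a, φ a = 0 → a ∈ q := by
    intro a ha
    obtain ⟨⟨_, n, rfl⟩, hn⟩ :=
      (IsLocalization.map_eq_zero_iff (Submonoid.powers (Ideal.Quotient.mk q z)) L _).mp ha
    refine hz.pow n _ ?_
    rw [← Ideal.Quotient.eq_zero_iff_mem, map_mul, map_pow]
    exact hn
  obtain ⟨ζ, hζ⟩ : ∃ ζ, φ z * ζ = 1 :=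
    (IsLocalization.Away.algebraMap_isUnit (Ideal.Quotient.mk q z)).exists_right_inv
  let Ψ : R[X] →+* L := eval₂RingHom φ (φ f * ζ)
  have hΨ : ∀ i, Ψ (C (d i) * X + C (e i)) = 0 := by
    intro i
    have h1 : φ (z * e i + d i * f) = 0 := hφ0 _ (hroot i)
    simp only [Ψ, coe_eval₂RingHom, eval₂_add, eval₂_mul, eval₂_C, eval₂_X]
    simp only [map_add, map_mul] at h1
    calc φ (d i) * (φ f * ζ) + φ (e i)
        = (φ z * φ (e i) + φ (d i) * φ f) * ζ + φ (e i) * (1 - φ z * ζ) := by ring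
      _ = 0 := by rw [h1, hζ]; ring
  -- Induct on the degree of `h` in the kernel of the substitution `Ψ`. Clearing denominators shows
  -- that its top coefficient lies in the ideal of the `d i`, so some linear polynomials cancel it.
  have H : ∀ n (h : R[X]), (∀ k, n ≤ k → h.coeff k = 0) → Ψ h = 0 → h ∈ linearIdeal q d e := by
    intro n
    induction n with
    | zero =>
      intro h hh _
      have : h = 0 := Polynomial.ext fun k => by simpa using hh k (Nat.zero_le _)
      rw [this]; exact Ideal.zero_mem _
    | succ n ih =>
      intro h hh h0
      have hsum : Ψ h = ∑ k ∈ Finset.range (n + 1), φ (h.coeff k) * (φ f * ζ) ^ k := by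
        refine eval₂_eq_sum_range' φ ?_ _
        by_contra hcon
        have hne : h ≠ 0 := by rintro rfl; simp at hcon
        exact hne (leadingCoeff_eq_zero.mp (hh _ (not_lt.mp hcon)))
      have hq1 : ∑ k ∈ Finset.range (n + 1), h.coeff k * f ^ k * z ^ (n - k) ∈ q := by
        refine hφ _ ?_
        have : φ (∑ k ∈ Finset.range (n + 1), h.coeff k * f ^ k * z ^ (n - k)) =
            φ z ^ n * Ψ h := by
          rw [hsum, map_sum, Finset.mul_sum]
          refine Finset.sum_congr rfl fun k hk => ?_
          have hkn : k ≤ n := Nat.lt_succ_iff.mp (Finset.mem_range.mp hk)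
          have hz1 : φ z ^ k * ζ ^ k = 1 := by rw [← mul_pow, hζ, one_pow]
          rw [map_mul, map_mul, map_pow, map_pow, mul_pow]
          nth_rewrite 2 [← Nat.sub_add_cancel hkn]
          rw [pow_add]
          linear_combination (-(φ (h.coeff k) * φ f ^ k * φ z ^ (n - k))) * hz1
        rw [this, h0, mul_zero]
      have htop : h.coeff n ∈ q ⊔ Ideal.span (Set.range d) := by
        refine hf.pow n _ ?_
        rw [Finset.sum_range_succ, Nat.sub_self, pow_zero, mul_one] at hq1
        have h2 : ∑ k ∈ Finset.range n, h.coeff k * f ^ k * z ^ (n - k) ∈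
            q ⊔ Ideal.span (Set.range d) := by
          refine Ideal.sum_mem _ fun k hk => Ideal.mul_mem_left _ _ (Ideal.mem_sup_right ?_)
          exact Ideal.pow_mem_of_mem _ hzd _ (Nat.sub_pos_of_lt (Finset.mem_range.mp hk))
        have := Ideal.sub_mem _ (Ideal.mem_sup_left hq1) h2
        rwa [add_sub_cancel_left, mul_comm] at this
      cases n with
      | zero =>
        have hC : h = C (h.coeff 0) := by
          ext k
          cases k with
          | zero => simp
          | succ k => rw [hh _ (by omega), coeff_C_of_ne_zero (by omega)]
        refine Ideal.mem_sup_left ?_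
        rw [hC] at h0 ⊢
        exact Ideal.mem_map_of_mem _ (hφ _ (by simpa [Ψ] using h0))
      | succ m =>
        obtain ⟨c, hc⟩ := exists_sum_of_mem_sup_span htop
        have hm1 : C (h.coeff (m + 1) - ∑ i, c i * d i) * X ^ (m + 1) ∈ q.map (C : R →+* R[X]) :=
          Ideal.mul_mem_right _ _ (Ideal.mem_map_of_mem _ hc)
        have hm2 : ∑ i, C (c i) * X ^ m * (C (d i) * X + C (e i)) ∈ linearIdeal q d e :=
          Ideal.sum_mem _ fun i _ => Ideal.mul_mem_left _ _
            (Ideal.mem_sup_right (Ideal.subset_span ⟨i, rfl⟩))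
        have hsplit : ∑ i, C (c i) * X ^ m * (C (d i) * X + C (e i)) =
            C (∑ i, c i * d i) * X ^ (m + 1) + C (∑ i, c i * e i) * X ^ m := by
          simp only [map_sum, Finset.sum_mul, ← Finset.sum_add_distrib, C_mul]
          exact Finset.sum_congr rfl fun i _ => by ring
        have key := ih (h - C (h.coeff (m + 1) - ∑ i, c i * d i) * X ^ (m + 1) -
            ∑ i, C (c i) * X ^ m * (C (d i) * X + C (e i))) (by
          intro k hk
          have h3 := coeff_sub_C_mul_X_pow_eq_zero hh k hk
          have h4 : h - C (h.coeff (m + 1) - ∑ i, c i * d i) * X ^ (m + 1) -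
              ∑ i, C (c i) * X ^ m * (C (d i) * X + C (e i)) =
              (h - C (h.coeff (m + 1)) * X ^ (m + 1)) - C (∑ i, c i * e i) * X ^ m := by
            rw [hsplit, C_sub]; ring
          rw [h4, coeff_sub, h3, coeff_C_mul_X_pow, if_neg (by omega), sub_zero]) (by
          have h5 : Ψ (C (h.coeff (m + 1) - ∑ i, c i * d i) * X ^ (m + 1)) = 0 := by
            have : Ψ (C (h.coeff (m + 1) - ∑ i, c i * d i)) = 0 := by
              simp only [Ψ, coe_eval₂RingHom, eval₂_C]; exact hφ0 _ hc
            rw [map_mul, this, zero_mul]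
          rw [map_sub, map_sub, h0, h5, map_sum]
          simp only [map_mul Ψ (_ * _), hΨ, mul_zero, Finset.sum_const_zero, sub_zero])
        have := Ideal.add_mem _ (Ideal.add_mem _ key hm2) (Ideal.mem_sup_left hm1)
        convert this using 1
        ring
  intro h hh
  obtain ⟨n, hn⟩ := exists_coeff_bound fun _ : Unit => h
  refine H n h (hn ()) ?_
  have h1 : linearIdeal q d e ≤ RingHom.ker Ψ := by
    rw [linearIdeal, sup_le_iff, Ideal.map_le_iff_le_comap, Ideal.span_le]
    refine ⟨fun a ha => ?_, ?_⟩
    · simp only [Ideal.mem_comap, RingHom.mem_ker, Ψ, coe_eval₂RingHom, eval₂_C]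
      exact hφ0 a ha
    · rintro _ ⟨i, rfl⟩
      exact hΨ i
  have h2 : Ψ (C z * h) = 0 := h1 hh
  have h3 : Ψ (C z) = φ z := by simp [Ψ]
  rw [map_mul, h3] at h2
  calc Ψ h = (φ z * ζ) * Ψ h := by rw [hζ, one_mul]
    _ = ζ * (φ z * Ψ h) := by ring
    _ = 0 := by rw [h2, mul_zero]

end Regular

/-! ### Ideals in disjoint sets of variables -/

section Supported

open MvPolynomial

variable {K : Type*} [Field K] {σ : Type*}

/-- The ideal `I` is generated by polynomials in the variables of `c`. -/
def GeneratedOn (c : Set σ) (I : Ideal (MvPolynomial σ K)) : Prop :=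
  ∃ A : Set (MvPolynomial σ K), A ⊆ supported K c ∧ I = Ideal.span A

theorem generatedOn_span {c : Set σ} {A : Set (MvPolynomial σ K)}
    (h : ∀ f ∈ A, f ∈ supported K c) : GeneratedOn c (Ideal.span A) := ⟨A, h, rfl⟩

theorem GeneratedOn.sup {c : Set σ} {I J : Ideal (MvPolynomial σ K)} (hI : GeneratedOn c I)
    (hJ : GeneratedOn c J) : GeneratedOn c (I ⊔ J) := by
  obtain ⟨A, hA, rfl⟩ := hI
  obtain ⟨B, hB, rfl⟩ := hJ
  exact ⟨A ∪ B, Set.union_subset hA hB, (Ideal.span_union A B).symm⟩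

theorem GeneratedOn.mono {c c' : Set σ} (h : c ⊆ c') {I : Ideal (MvPolynomial σ K)}
    (hI : GeneratedOn c I) : GeneratedOn c' I := by
  obtain ⟨A, hA, rfl⟩ := hI
  exact ⟨A, fun f hf => supported_mono h (hA hf), rfl⟩

theorem algHom_eq_of_mem_supported {B : Type*} [Semiring B] [Algebra K B] {c : Set σ}
    {φ ψ : MvPolynomial σ K →ₐ[K] B} (h : ∀ i ∈ c, φ (X i) = ψ (X i)) {f : MvPolynomial σ K}
    (hf : f ∈ supported K c) : φ f = ψ f := by
  rw [supported_eq_adjoin_X] at hf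
  refine AlgHom.eqOn_adjoin_iff.mpr ?_ hf
  rintro _ ⟨i, hi, rfl⟩
  exact h i hi

theorem GeneratedOn.map_le {B : Type*} [CommRing B] [Algebra K B] {c : Set σ}
    {φ ψ : MvPolynomial σ K →ₐ[K] B} (h : ∀ i ∈ c, φ (X i) = ψ (X i))
    {I : Ideal (MvPolynomial σ K)} (hI : GeneratedOn c I) :
    ∀ a ∈ I, φ a ∈ I.map ψ := by
  obtain ⟨A, hA, rfl⟩ := hI
  have : Ideal.span A ≤ ((Ideal.span A).map ψ).comap φ := by
    rw [Ideal.span_le]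
    intro f hf
    rw [SetLike.mem_coe, Ideal.mem_comap, algHom_eq_of_mem_supported h (hA hf)]
    exact Ideal.mem_map_of_mem _ (Ideal.subset_span hf)
  exact fun a ha => this ha

open scoped TensorProduct in
/-- The quotients by `I`, `J` and `I ⊔ J` are taken here as abstract algebras `E`, `A` and `Q`. A
basis of `E` over the field `K` is a basis of `A ⊗ E` over `A`, and the coordinates of a syzygy in
this basis are syzygies modulo `J`. -/
theorem exists_syzygy_of_algHom {c₁ c₂ : Set σ} (hc : Disjoint c₁ c₂)
    {I J : Ideal (MvPolynomial σ K)} (hI : GeneratedOn c₁ I) (hJ : GeneratedOn c₂ J)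
    {A E Q : Type*} [CommRing A] [Algebra K A] [CommRing E] [Algebra K E] [CommRing Q] [Algebra K Q]
    (πA : MvPolynomial σ K →ₐ[K] A) (πE : MvPolynomial σ K →ₐ[K] E) (πQ : MvPolynomial σ K →ₐ[K] Q)
    (hA : ∀ f, πA f = 0 ↔ f ∈ J) (hE : ∀ f, πE f = 0 ↔ f ∈ I) (hQ : ∀ f, πQ f = 0 ↔ f ∈ I ⊔ J)
    (sA : Function.Surjective πA) (sE : Function.Surjective πE)
    (fA : A →ₐ[K] Q) (fE : E →ₐ[K] Q) (hfA : ∀ f, fA (πA f) = πQ f) (hfE : ∀ f, fE (πE f) = πQ f)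
    {ι : Type*} [Fintype ι] {d : ι → MvPolynomial σ K} (hd : ∀ i, d i ∈ supported K c₂)
    {a : ι → MvPolynomial σ K} (ha : ∑ i, a i * d i ∈ I ⊔ J) :
    ∃ b : ι → MvPolynomial σ K, ∑ i, b i * d i ∈ J ∧ ∀ i, a i - b i ∈ I ⊔ J := by
  classical
  let Φ : MvPolynomial σ K →ₐ[K] A ⊗[K] E := aeval fun i =>
    if i ∈ c₂ then πA (X i) ⊗ₜ[K] (1 : E) else (1 : A) ⊗ₜ[K] πE (X i)
  let iA : MvPolynomial σ K →ₐ[K] A ⊗[K] E := Algebra.TensorProduct.includeLeft.comp πA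
  let iE : MvPolynomial σ K →ₐ[K] A ⊗[K] E := Algebra.TensorProduct.includeRight.comp πE
  have hΦA : ∀ f ∈ supported K c₂, Φ f = iA f := fun f hf =>
    algHom_eq_of_mem_supported (fun i hi => by simp [Φ, iA, aeval_X, hi]) hf
  have hΦE : ∀ f ∈ supported K c₁, Φ f = iE f := fun f hf =>
    algHom_eq_of_mem_supported (fun i hi => by
      have : i ∉ c₂ := fun h => Set.disjoint_left.mp hc hi h
      simp [Φ, iE, aeval_X, this]) hf
  have hΦ : I ⊔ J ≤ RingHom.ker Φ := by
    obtain ⟨S, hS, rfl⟩ := hI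
    obtain ⟨T, hT, rfl⟩ := hJ
    rw [sup_le_iff, Ideal.span_le, Ideal.span_le]
    refine ⟨fun f hf => ?_, fun f hf => ?_⟩
    · rw [SetLike.mem_coe, RingHom.mem_ker, hΦE f (hS hf), AlgHom.comp_apply,
        (hE f).mpr (Ideal.subset_span hf), map_zero]
    · rw [SetLike.mem_coe, RingHom.mem_ker, hΦA f (hT hf), AlgHom.comp_apply,
        (hA f).mpr (Ideal.subset_span hf), map_zero]
  let m : A ⊗[K] E →ₐ[K] Q := Algebra.TensorProduct.productMap fA fE
  have hm : ∀ f, m (Φ f) = πQ f := by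
    intro f
    have : m.comp Φ = πQ := by
      refine MvPolynomial.algHom_ext fun i => ?_
      by_cases hi : i ∈ c₂ <;> simp [m, Φ, aeval_X, hi, hfA, hfE]
    exact DFunLike.congr_fun this f
  let bE := Module.Basis.ofVectorSpace K E
  let bT := Algebra.TensorProduct.basis A bE
  let S := Finset.univ.biUnion fun i => (bT.repr (Φ (a i))).support
  choose lA hlA using sA
  choose lE hlE using sE
  refine ⟨fun i => ∑ k ∈ S, lE (bE k) * lA (bT.repr (Φ (a i)) k), ?_, fun i => ?_⟩
  · have h1 : ∀ k, ∑ i, lA (bT.repr (Φ (a i)) k) * d i ∈ J := by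
      intro k
      rw [← hA, map_sum]
      have h0 : Φ (∑ i, a i * d i) = 0 := hΦ ha
      have h2 : bT.repr (Φ (∑ i, a i * d i)) k = 0 := by rw [h0]; simp
      rw [← h2, map_sum, map_sum, Finsupp.finsetSum_apply]
      refine Finset.sum_congr rfl fun i _ => ?_
      have h3 : Φ (a i * d i) = (πA (d i)) • Φ (a i) := by
        rw [map_mul, hΦA _ (hd i), Algebra.smul_def, mul_comm]
        rfl
      rw [h3, map_smul, Finsupp.smul_apply, map_mul, hlA, smul_eq_mul, mul_comm]
    have h2 : ∑ i, (∑ k ∈ S, lE (bE k) * lA (bT.repr (Φ (a i)) k)) * d i =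
        ∑ k ∈ S, lE (bE k) * ∑ i, lA (bT.repr (Φ (a i)) k) * d i := by
      simp only [Finset.sum_mul, Finset.mul_sum]
      rw [Finset.sum_comm]
      simp only [mul_assoc]
    rw [h2]
    exact Ideal.sum_mem _ fun k _ => Ideal.mul_mem_left _ _ (h1 k)
  · rw [← hQ, map_sub, sub_eq_zero, ← hm, map_sum]
    have h1 : Φ (a i) = ∑ k ∈ S, bT.repr (Φ (a i)) k • bT k := by
      conv_lhs => rw [← bT.linearCombination_repr (Φ (a i)), Finsupp.linearCombination_apply]
      refine Finsupp.sum_of_support_subset _ ?_ _ (by simp)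
      exact Finset.subset_biUnion_of_mem (fun i => (bT.repr (Φ (a i))).support)
        (Finset.mem_univ i)
    conv_lhs => rw [h1, map_sum]
    refine Finset.sum_congr rfl fun k _ => ?_
    have h2 : bT k = 1 ⊗ₜ bE k := Algebra.TensorProduct.basis_apply bE k
    rw [h2, TensorProduct.smul_tmul', smul_eq_mul, mul_one]
    conv_lhs => rw [← hlA (bT.repr (Φ (a i)) k), ← hlE (bE k)]
    rw [Algebra.TensorProduct.productMap_apply_tmul, map_mul, mul_comm, hfA, hfE]

/-- Flatness over a field, in terms of disjoint sets of variables: a syzygy modulo `I + J` of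
polynomials `d i` in the second set of variables is, modulo `I + J`, a syzygy modulo `J`. -/
theorem exists_syzygy_of_disjoint {c₁ c₂ : Set σ} (hc : Disjoint c₁ c₂)
    {I J : Ideal (MvPolynomial σ K)} (hI : GeneratedOn c₁ I) (hJ : GeneratedOn c₂ J)
    {ι : Type*} [Fintype ι] {d : ι → MvPolynomial σ K} (hd : ∀ i, d i ∈ supported K c₂)
    {a : ι → MvPolynomial σ K} (ha : ∑ i, a i * d i ∈ I ⊔ J) :
    ∃ b : ι → MvPolynomial σ K, ∑ i, b i * d i ∈ J ∧ ∀ i, a i - b i ∈ I ⊔ J :=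
  exists_syzygy_of_algHom hc hI hJ (Ideal.Quotient.mkₐ K J) (Ideal.Quotient.mkₐ K I)
    (Ideal.Quotient.mkₐ K (I ⊔ J)) (fun _ => Ideal.Quotient.eq_zero_iff_mem)
    (fun _ => Ideal.Quotient.eq_zero_iff_mem) (fun _ => Ideal.Quotient.eq_zero_iff_mem)
    (Ideal.Quotient.mkₐ_surjective K J) (Ideal.Quotient.mkₐ_surjective K I)
    (Ideal.Quotient.factorₐ K le_sup_right) (Ideal.Quotient.factorₐ K le_sup_left)
    (fun _ => rfl) (fun _ => rfl) hd ha

theorem RegularMod.sup_of_disjoint {c₁ c₂ : Set σ} (hc : Disjoint c₁ c₂)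
    {I J : Ideal (MvPolynomial σ K)} (hI : GeneratedOn c₁ I) (hJ : GeneratedOn c₂ J)
    {x : MvPolynomial σ K} (hx : x ∈ supported K c₂) (h : RegularMod J x) :
    RegularMod (I ⊔ J) x := by
  intro q hq
  obtain ⟨b, hb, hab⟩ := exists_syzygy_of_disjoint hc hI hJ (ι := Unit) (d := fun _ => x)
    (fun _ => hx) (a := fun _ => q) (by simpa [mul_comm] using hq)
  have hb' : b () ∈ J := h _ (by simpa [mul_comm] using hb)
  simpa using Ideal.add_mem _ (hab ()) (Ideal.mem_sup_right hb')

end Supported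

/-! ### The ideals of a forest and splitting at an edge -/

section Relations

open MvPolynomial

/-- Index type of the variables `x_v`, `y_v` and `T_(u,v)`. -/
abbrev TreeVar (V : Type*) := V ⊕ V ⊕ V × V

variable (K : Type*) [Field K] {V : Type*}

/-- The variable `x_v`. -/
noncomputable def xVar (v : V) : MvPolynomial (TreeVar V) K := X (Sum.inl v)

/-- The variable `y_v`. -/
noncomputable def yVar (v : V) : MvPolynomial (TreeVar V) K := X (Sum.inr (Sum.inl v))

/-- The symbol of the oriented edge `(u, v)`, a difference of two variables so that reversing the
orientation changes its sign. -/
noncomputable def edgeSymbol (u v : V) : MvPolynomial (TreeVar V) K :=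
  X (Sum.inr (Sum.inr (u, v))) - X (Sum.inr (Sum.inr (v, u)))

/-- The minor `x_a y_b - x_b y_a`. -/
noncomputable def minor (a b : V) : MvPolynomial (TreeVar V) K :=
  xVar K a * yVar K b - xVar K b * yVar K a

/-- The determinant of the columns `(x_v, y_v, T_(w,v))` for `v = a, b, c`. It is the linear
relation among the edge binomials of the star with centre `w` and leaves `a`, `b`, `c`. -/
noncomputable def plucker (w a b c : V) : MvPolynomial (TreeVar V) K :=
  minor K a b * edgeSymbol K w c - minor K a c * edgeSymbol K w b + minor K b c * edgeSymbol K w a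

/-- The ideal presenting the associated graded ring of the binomial edge ideal of a forest `G`: the
minors of the edges and the Plücker relations of the stars. -/
noncomputable def gradedIdeal (G : SimpleGraph V) : Ideal (MvPolynomial (TreeVar V) K) :=
  Ideal.span ({f | ∃ u v, G.Adj u v ∧ f = minor K u v} ∪
    {f | ∃ w a b c, G.Adj w a ∧ G.Adj w b ∧ G.Adj w c ∧ f = plucker K w a b c})

/-- The ideal of the minors `x_a y_b - x_b y_a` with `a`, `b` neighbours of `p`. -/
noncomputable def cliqueIdeal (G : SimpleGraph V) (p : V) : Ideal (MvPolynomial (TreeVar V) K) :=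
  Ideal.span {f | ∃ a b, G.Adj p a ∧ G.Adj p b ∧ f = minor K a b}

/-- The ideal `gradedIdeal` together with the minors of the neighbours of `p`. -/
noncomputable def markedIdeal (G : SimpleGraph V) (p : V) : Ideal (MvPolynomial (TreeVar V) K) :=
  gradedIdeal K G ⊔ cliqueIdeal K G p

/-- The ideal of the variables `y_b` with `b` in the closed neighbourhood of `p`. -/
noncomputable def yIdeal (G : SimpleGraph V) (p : V) : Ideal (MvPolynomial (TreeVar V) K) :=
  Ideal.span (Set.range fun b : {b // b = p ∨ G.Adj p b} => yVar K b.1)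

variable {K}

theorem edgeSymbol_swap (u v : V) : edgeSymbol K v u = -edgeSymbol K u v := by
  simp [edgeSymbol]

theorem minor_swap (a b : V) : minor K b a = -minor K a b := by
  simp [minor]

theorem minor_self (a : V) : minor K a a = 0 := by simp [minor]

variable {G : SimpleGraph V}

theorem minor_mem_gradedIdeal {u v : V} (h : G.Adj u v) : minor K u v ∈ gradedIdeal K G :=
  Ideal.subset_span (Or.inl ⟨u, v, h, rfl⟩)

theorem plucker_mem_gradedIdeal {w a b c : V} (ha : G.Adj w a) (hb : G.Adj w b)
    (hc : G.Adj w c) : plucker K w a b c ∈ gradedIdeal K G :=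
  Ideal.subset_span (Or.inr ⟨w, a, b, c, ha, hb, hc, rfl⟩)

theorem minor_mem_cliqueIdeal {p a b : V} (ha : G.Adj p a) (hb : G.Adj p b) :
    minor K a b ∈ cliqueIdeal K G p :=
  Ideal.subset_span ⟨a, b, ha, hb, rfl⟩

theorem gradedIdeal_le {I : Ideal (MvPolynomial (TreeVar V) K)}
    (h₁ : ∀ u v, G.Adj u v → minor K u v ∈ I)
    (h₂ : ∀ w a b c, G.Adj w a → G.Adj w b → G.Adj w c → plucker K w a b c ∈ I) :
    gradedIdeal K G ≤ I := by
  rw [gradedIdeal, Ideal.span_le]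
  rintro _ (⟨u, v, h, rfl⟩ | ⟨w, a, b, c, ha, hb, hc, rfl⟩)
  exacts [h₁ u v h, h₂ w a b c ha hb hc]

theorem cliqueIdeal_le {I : Ideal (MvPolynomial (TreeVar V) K)} {p : V}
    (h : ∀ a b, G.Adj p a → G.Adj p b → minor K a b ∈ I) : cliqueIdeal K G p ≤ I := by
  rw [cliqueIdeal, Ideal.span_le]
  rintro _ ⟨a, b, ha, hb, rfl⟩
  exact h a b ha hb

theorem gradedIdeal_mono {G G' : SimpleGraph V} (h : G ≤ G') :
    gradedIdeal K G ≤ gradedIdeal K G' :=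
  gradedIdeal_le (fun _ _ huv => minor_mem_gradedIdeal (h huv))
    fun _ _ _ _ ha hb hc => plucker_mem_gradedIdeal (h ha) (h hb) (h hc)

theorem cliqueIdeal_mono {G G' : SimpleGraph V} (h : G ≤ G') (p : V) :
    cliqueIdeal K G p ≤ cliqueIdeal K G' p :=
  cliqueIdeal_le fun _ _ ha hb => minor_mem_cliqueIdeal (h ha) (h hb)

theorem markedIdeal_mono {G G' : SimpleGraph V} (h : G ≤ G') (p : V) :
    markedIdeal K G p ≤ markedIdeal K G' p :=
  sup_le_sup (gradedIdeal_mono h) (cliqueIdeal_mono h p)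

theorem plucker_mem_of_minor_mem {I : Ideal (MvPolynomial (TreeVar V) K)} (w : V) {a b c : V}
    (h₁ : minor K a b ∈ I) (h₂ : minor K a c ∈ I) (h₃ : minor K b c ∈ I) :
    plucker K w a b c ∈ I :=
  Ideal.add_mem _ (Ideal.sub_mem _ (Ideal.mul_mem_right _ _ h₁) (Ideal.mul_mem_right _ _ h₂))
    (Ideal.mul_mem_right _ _ h₃)

/-- If `a`, `b` are neighbours of `p`, then `x_p * minor a b` is a combination of the minors of the
edges `p a` and `p b`. -/
theorem xVar_mul_cliqueIdeal {p : V} {f : MvPolynomial (TreeVar V) K}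
    (hf : f ∈ cliqueIdeal K G p) : xVar K p * f ∈ gradedIdeal K G := by
  suffices h : cliqueIdeal K G p ≤ (gradedIdeal K G).colon {xVar K p} by
    have := Submodule.mem_colon_singleton.mp (h hf)
    rwa [smul_eq_mul, mul_comm] at this
  refine cliqueIdeal_le fun a b ha hb => Submodule.mem_colon_singleton.mpr ?_
  have : minor K a b • xVar K p = xVar K a * minor K p b - xVar K b * minor K p a := by
    simp only [minor, smul_eq_mul]; ring
  rw [this]
  exact Ideal.sub_mem _ (Ideal.mul_mem_left _ _ (minor_mem_gradedIdeal hb))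
    (Ideal.mul_mem_left _ _ (minor_mem_gradedIdeal ha))

theorem yVar_mul_cliqueIdeal {p : V} {f : MvPolynomial (TreeVar V) K}
    (hf : f ∈ cliqueIdeal K G p) : yVar K p * f ∈ gradedIdeal K G := by
  suffices h : cliqueIdeal K G p ≤ (gradedIdeal K G).colon {yVar K p} by
    have := Submodule.mem_colon_singleton.mp (h hf)
    rwa [smul_eq_mul, mul_comm] at this
  refine cliqueIdeal_le fun a b ha hb => Submodule.mem_colon_singleton.mpr ?_
  have : minor K a b • yVar K p = yVar K a * minor K p b - yVar K b * minor K p a := by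
    simp only [minor, smul_eq_mul]; ring
  rw [this]
  exact Ideal.sub_mem _ (Ideal.mul_mem_left _ _ (minor_mem_gradedIdeal hb))
    (Ideal.mul_mem_left _ _ (minor_mem_gradedIdeal ha))

/-- Exchanging the variables `x` and `y` preserves the marked ideal. -/
theorem regularMod_yVar_of_xVar {p : V} (h : RegularMod (markedIdeal K G p) (xVar K p)) :
    RegularMod (markedIdeal K G p) (yVar K p) := by
  let φ : MvPolynomial (TreeVar V) K →ₐ[K] MvPolynomial (TreeVar V) K :=
    aeval (Sum.elim (yVar K) (Sum.elim (xVar K) fun e => X (Sum.inr (Sum.inr e))))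
  have hx : ∀ v : V, φ (xVar K v) = yVar K v := fun v => by simp [φ, xVar]
  have hy : ∀ v : V, φ (yVar K v) = xVar K v := fun v => by simp [φ, yVar]
  have ht : ∀ u v : V, φ (edgeSymbol K u v) = edgeSymbol K u v := fun u v => by
    simp [φ, edgeSymbol]
  have hd : ∀ a b : V, φ (minor K a b) = -minor K a b := fun a b => by
    simp only [minor, map_sub, map_mul, hx, hy]; ring
  have hk : ∀ w a b c : V, φ (plucker K w a b c) = -plucker K w a b c := fun w a b c => by
    simp only [plucker, map_sub, map_add, map_mul, hd, ht]; ring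
  have hI : markedIdeal K G p ≤ (markedIdeal K G p).comap φ := by
    refine sup_le (gradedIdeal_le ?_ ?_) (cliqueIdeal_le ?_)
    · intro u v huv
      rw [Ideal.mem_comap, hd]
      exact neg_mem (Ideal.mem_sup_left (minor_mem_gradedIdeal huv))
    · intro w a b c ha hb hc
      rw [Ideal.mem_comap, hk]
      exact neg_mem (Ideal.mem_sup_left (plucker_mem_gradedIdeal ha hb hc))
    · intro a b ha hb
      rw [Ideal.mem_comap, hd]
      exact neg_mem (Ideal.mem_sup_right (minor_mem_cliqueIdeal ha hb))
  have hφφ : ∀ q, φ (φ q) = q := by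
    intro q
    have : φ.comp φ = AlgHom.id K _ := by
      refine MvPolynomial.algHom_ext fun i => ?_
      rcases i with v | v | e <;> simp [φ, xVar, yVar]
    exact DFunLike.congr_fun this q
  intro q hq
  have h1 : φ q ∈ markedIdeal K G p := by
    refine h _ ?_
    rw [← hy, ← map_mul]
    exact hI hq
  rw [← hφφ q]
  exact hI h1

/-- The variables attached to vertices of `C` and to pairs of vertices of `C`. -/
def varsOn (C : Set V) : Set (TreeVar V) :=
  {i | Sum.elim (· ∈ C) (Sum.elim (· ∈ C) fun e => e.1 ∈ C ∧ e.2 ∈ C) i}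

theorem disjoint_varsOn_compl (C : Set V) : Disjoint (varsOn C) (varsOn Cᶜ) := by
  rw [Set.disjoint_left]
  rintro (v | v | e) h h'
  exacts [h' h, h' h, h'.1 h.1]

theorem xVar_mem_supported {c : Set (TreeVar V)} {v : V} (h : Sum.inl v ∈ c) :
    xVar K v ∈ supported K c := X_mem_supported.mpr h

theorem yVar_mem_supported {c : Set (TreeVar V)} {v : V} (h : Sum.inr (Sum.inl v) ∈ c) :
    yVar K v ∈ supported K c := X_mem_supported.mpr h

theorem minor_mem_supported {C : Set V} {a b : V} (ha : a ∈ C) (hb : b ∈ C) :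
    minor K a b ∈ supported K (varsOn C) :=
  sub_mem (mul_mem (xVar_mem_supported ha) (yVar_mem_supported hb))
    (mul_mem (xVar_mem_supported hb) (yVar_mem_supported ha))

theorem edgeSymbol_mem_supported {C : Set V} {a b : V} (ha : a ∈ C) (hb : b ∈ C) :
    edgeSymbol K a b ∈ supported K (varsOn C) :=
  sub_mem (X_mem_supported.mpr ⟨ha, hb⟩) (X_mem_supported.mpr ⟨hb, ha⟩)

theorem plucker_mem_supported {C : Set V} {w a b c : V} (hw : w ∈ C) (ha : a ∈ C) (hb : b ∈ C)
    (hc : c ∈ C) : plucker K w a b c ∈ supported K (varsOn C) :=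
  add_mem (sub_mem (mul_mem (minor_mem_supported ha hb) (edgeSymbol_mem_supported hw hc))
    (mul_mem (minor_mem_supported ha hc) (edgeSymbol_mem_supported hw hb)))
    (mul_mem (minor_mem_supported hb hc) (edgeSymbol_mem_supported hw ha))

theorem generatedOn_gradedIdeal {C : Set V} (h : ∀ u v, G.Adj u v → u ∈ C ∧ v ∈ C) :
    GeneratedOn (varsOn C) (gradedIdeal K G) := by
  refine generatedOn_span ?_
  rintro _ (⟨u, v, huv, rfl⟩ | ⟨w, a, b, c, ha, hb, hc, rfl⟩)
  · exact minor_mem_supported (h u v huv).1 (h u v huv).2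
  · exact plucker_mem_supported (h _ _ ha).1 (h _ _ ha).2 (h _ _ hb).2 (h _ _ hc).2

theorem generatedOn_cliqueIdeal {C : Set V} (h : ∀ u v, G.Adj u v → u ∈ C ∧ v ∈ C) (p : V) :
    GeneratedOn (varsOn C) (cliqueIdeal K G p) := by
  refine generatedOn_span ?_
  rintro _ ⟨a, b, ha, hb, rfl⟩
  exact minor_mem_supported (h _ _ ha).2 (h _ _ hb).2

theorem generatedOn_markedIdeal {C : Set V} (h : ∀ u v, G.Adj u v → u ∈ C ∧ v ∈ C) (p : V) :
    GeneratedOn (varsOn C) (markedIdeal K G p) :=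
  (generatedOn_gradedIdeal h).sup (generatedOn_cliqueIdeal h p)

theorem generatedOn_yIdeal {C : Set V} (h : ∀ u v, G.Adj u v → u ∈ C ∧ v ∈ C) {p : V}
    (hp : p ∈ C) : GeneratedOn (varsOn C) (yIdeal K G p) := by
  refine generatedOn_span ?_
  rintro _ ⟨⟨b, rfl | hb⟩, rfl⟩
  exacts [yVar_mem_supported hp, yVar_mem_supported (h _ _ hb).2]

end Relations

section Splitting

variable {V : Type*}

/-- The graph `G` has an edge `p a` whose removal splits it into `G₁`, with edges inside `C ∋ p`,
and `G₂`, with edges outside `C` (where `a` lies). -/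
structure EdgeSplit (G G₁ G₂ : SimpleGraph V) (C : Set V) (p a : V) : Prop where
  mem : p ∈ C
  notMem : a ∉ C
  left : ∀ u v, G₁.Adj u v → u ∈ C ∧ v ∈ C
  right : ∀ u v, G₂.Adj u v → u ∈ Cᶜ ∧ v ∈ Cᶜ
  adj_iff : ∀ u v, G.Adj u v ↔ G₁.Adj u v ∨ G₂.Adj u v ∨ (u = p ∧ v = a) ∨ (u = a ∧ v = p)

/-- In a forest every edge is a bridge; `C` is the component of `p` after its removal. -/
theorem exists_edgeSplit {G : SimpleGraph V} (hG : G.IsAcyclic) {p a : V} (h : G.Adj p a) :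
    ∃ (G₁ G₂ : SimpleGraph V) (C : Set V), EdgeSplit G G₁ G₂ C p a ∧ G₁ ⊔ G₂ < G := by
  have hb := SimpleGraph.isAcyclic_iff_forall_adj_isBridge.mp hG h
  let G' := G.deleteEdges {s(p, a)}
  let C : Set V := {v | G'.Reachable p v}
  have hC : ∀ u v, G'.Adj u v → (u ∈ C ↔ v ∈ C) := fun u v huv =>
    ⟨fun hu => hu.trans huv.reachable, fun hv => hv.trans huv.symm.reachable⟩
  let G₁ : SimpleGraph V :=
    { Adj := fun u v => G'.Adj u v ∧ u ∈ C ∧ v ∈ C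
      symm := ⟨fun u v h => ⟨h.1.symm, h.2.2, h.2.1⟩⟩
      loopless := ⟨fun u h => G'.loopless.irrefl u h.1⟩ }
  let G₂ : SimpleGraph V :=
    { Adj := fun u v => G'.Adj u v ∧ u ∈ Cᶜ ∧ v ∈ Cᶜ
      symm := ⟨fun u v h => ⟨h.1.symm, h.2.2, h.2.1⟩⟩
      loopless := ⟨fun u h => G'.loopless.irrefl u h.1⟩ }
  have hadj : ∀ u v, G'.Adj u v ↔ G₁.Adj u v ∨ G₂.Adj u v := by
    intro u v
    constructor
    · intro huv
      by_cases hu : u ∈ C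
      · exact Or.inl ⟨huv, hu, (hC u v huv).mp hu⟩
      · exact Or.inr ⟨huv, hu, fun hv => hu ((hC u v huv).mpr hv)⟩
    · rintro (h | h) <;> exact h.1
  have hG' : ∀ u v, G'.Adj u v ↔ G.Adj u v ∧ s(u, v) ≠ s(p, a) := by
    intro u v
    simp [G', SimpleGraph.deleteEdges_adj]
  have ha : a ∉ C := (SimpleGraph.isBridge_iff.mp hb)
  refine ⟨G₁, G₂, C, ⟨SimpleGraph.Reachable.refl _, ha, fun u v h => h.2, fun u v h => h.2, ?_⟩, ?_⟩
  · intro u v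
    rw [← or_assoc, ← hadj, hG', ← Sym2.eq_iff]
    constructor
    · intro huv
      by_cases he : s(u, v) = s(p, a)
      exacts [Or.inr he, Or.inl ⟨huv, he⟩]
    · rintro (h' | h')
      · exact h'.1
      · rw [← SimpleGraph.mem_edgeSet, h']; exact h
  · refine lt_of_le_of_ne ?_ ?_
    · intro u v huv
      exact ((hG' u v).mp ((hadj u v).mpr huv)).1
    · intro heq
      have h1 : (G₁ ⊔ G₂).Adj p a := heq ▸ h
      exact ((hG' p a).mp ((hadj p a).mpr h1)).2 rfl

variable {G G₁ G₂ : SimpleGraph V} {C : Set V} {p a : V}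

theorem EdgeSplit.adj_root_iff (s : EdgeSplit G G₁ G₂ C p a) {b : V} :
    G.Adj p b ↔ G₁.Adj p b ∨ b = a := by
  have hpa : p ≠ a := fun h => s.notMem (h ▸ s.mem)
  have h2 : ¬ G₂.Adj p b := fun h => (s.right _ _ h).1 s.mem
  rw [s.adj_iff]
  simp [h2, hpa]

theorem EdgeSplit.adj_branch_iff (s : EdgeSplit G G₁ G₂ C p a) {b : V} :
    G.Adj a b ↔ G₂.Adj a b ∨ b = p := by
  have hpa : a ≠ p := fun h => s.notMem (h ▸ s.mem)
  have h2 : ¬ G₁.Adj a b := fun h => s.notMem (s.left _ _ h).1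
  rw [s.adj_iff]
  simp [h2, hpa]

theorem EdgeSplit.left_le (s : EdgeSplit G G₁ G₂ C p a) : G₁ ≤ G :=
  fun _ _ h => (s.adj_iff _ _).mpr (Or.inl h)

theorem EdgeSplit.right_le (s : EdgeSplit G G₁ G₂ C p a) : G₂ ≤ G :=
  fun _ _ h => (s.adj_iff _ _).mpr (Or.inr (Or.inl h))

theorem EdgeSplit.adj_of_mem (s : EdgeSplit G G₁ G₂ C p a) {w b : V} (hw : w ∈ C) (hp : w ≠ p)
    (h : G.Adj w b) : G₁.Adj w b := by
  rcases (s.adj_iff _ _).mp h with h | h | ⟨h, -⟩ | ⟨h, -⟩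
  · exact h
  · exact absurd hw (s.right _ _ h).1
  · exact absurd h hp
  · exact absurd (h ▸ hw) s.notMem

theorem EdgeSplit.adj_of_notMem (s : EdgeSplit G G₁ G₂ C p a) {w b : V} (hw : w ∉ C) (ha : w ≠ a)
    (h : G.Adj w b) : G₂.Adj w b := by
  rcases (s.adj_iff _ _).mp h with h | h | ⟨h, -⟩ | ⟨h, -⟩
  · exact absurd (s.left _ _ h).1 hw
  · exact h
  · exact absurd (h ▸ s.mem) hw
  · exact absurd h ha

end Splitting

/-! ### Degenerations -/

section RankOne

variable {R : Type*} [CommRing R] {ι : Type*} [Fintype ι]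

/-- Regularity for the leading coefficients `yb i * u` of the minors `yb i * u - xb i * w`. -/
theorem regularMod_sup_span_mul {q H : Ideal R} {x u : R} {yb : ι → R}
    (hxu : RegularMod (q ⊔ Ideal.span {u}) x) (hu : ∀ k, u * k ∈ q → k ∈ q ⊔ H)
    (huH : ∀ k ∈ H, u * k ∈ q) (hxy : RegularMod (q ⊔ H ⊔ Ideal.span (Set.range yb)) x) :
    RegularMod (q ⊔ Ideal.span (Set.range fun i => yb i * u)) x := by
  intro h hh
  obtain ⟨c, hc⟩ := exists_sum_of_mem_sup_span hh
  have hsum : ∑ i, c i * (yb i * u) = (∑ i, c i * yb i) * u := by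
    rw [Finset.sum_mul]; exact Finset.sum_congr rfl fun i _ => by ring
  have h1 : h ∈ q ⊔ Ideal.span {u} := by
    refine hxu _ ?_
    have h2 : ∑ i, c i * (yb i * u) ∈ Ideal.span {u} := by
      rw [hsum]; exact Ideal.mul_mem_left _ _ (Ideal.mem_span_singleton_self u)
    simpa using Ideal.add_mem _ (Ideal.mem_sup_left (T := Ideal.span {u}) hc)
      (Ideal.mem_sup_right (S := q) h2)
  obtain ⟨m, hm, k', hk', rfl⟩ := Submodule.mem_sup.mp h1
  obtain ⟨k, rfl⟩ := Ideal.mem_span_singleton'.mp hk'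
  have h3 : x * k - ∑ i, c i * yb i ∈ q ⊔ H := by
    refine hu _ ?_
    have := Ideal.sub_mem _ hc (Ideal.mul_mem_left _ x hm)
    rw [hsum] at this
    convert this using 1
    ring
  have h4 : k ∈ q ⊔ H ⊔ Ideal.span (Set.range yb) := hxy _ (mem_sup_span_of_sum c h3)
  obtain ⟨c', hc'⟩ := exists_sum_of_mem_sup_span h4
  refine mem_sup_span_of_sum c' ?_
  have h5 : u * (k - ∑ i, c' i * yb i) ∈ q := by
    obtain ⟨v, hv, v', hv', hvv⟩ := Submodule.mem_sup.mp hc'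
    rw [← hvv, mul_add]
    exact Ideal.add_mem _ (Ideal.mul_mem_left _ _ hv) (huH _ hv')
  have hsum' : ∑ i, c' i * (yb i * u) = (∑ i, c' i * yb i) * u := by
    rw [Finset.sum_mul]; exact Finset.sum_congr rfl fun i _ => by ring
  have := Ideal.add_mem _ hm h5
  rw [hsum']
  convert this using 1
  ring

/-- Syzygies of the leading coefficients `yb i * u` of the minors `yb i * u - xb i * w` are
syzygies of the trailing coefficients. -/
theorem sum_mul_mem_of_proportional {q H : Ideal R} {x y u w : R} {xb yb : ι → R}
    (hu : ∀ k, u * k ∈ q → k ∈ q ⊔ H) (hwH : ∀ k ∈ H, w * k ∈ q)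
    (hy : RegularMod (q ⊔ H) y) (hprop : ∀ i, y * xb i - x * yb i ∈ q)
    (g : ι → R) (hg : ∑ i, g i * (yb i * u) ∈ q) : ∑ i, g i * -(xb i * w) ∈ q := by
  have hsum : ∑ i, g i * (yb i * u) = u * ∑ i, g i * yb i := by
    rw [Finset.mul_sum]; exact Finset.sum_congr rfl fun i _ => by ring
  have h1 : ∑ i, g i * yb i ∈ q ⊔ H := hu _ (by rwa [← hsum])
  have h2 : ∑ i, g i * xb i ∈ q ⊔ H := by
    refine hy _ ?_
    have h3 : y * ∑ i, g i * xb i =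
        ∑ i, g i * (y * xb i - x * yb i) + x * ∑ i, g i * yb i := by
      simp only [Finset.mul_sum, ← Finset.sum_add_distrib]
      exact Finset.sum_congr rfl fun i _ => by ring
    rw [h3]
    exact Ideal.add_mem _ (Ideal.mem_sup_left (Ideal.sum_mem _ fun i _ =>
      Ideal.mul_mem_left _ _ (hprop i))) (Ideal.mul_mem_left _ _ h1)
  have h4 : w * ∑ i, g i * xb i ∈ q := by
    obtain ⟨v, hv, v', hv', hvv⟩ := Submodule.mem_sup.mp h2
    rw [← hvv, mul_add]
    exact Ideal.add_mem _ (Ideal.mul_mem_left _ _ hv) (hwH _ hv')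
  have h5 : ∑ i, g i * -(xb i * w) = -(w * ∑ i, g i * xb i) := by
    rw [Finset.mul_sum, ← Finset.sum_neg_distrib]
    exact Finset.sum_congr rfl fun i _ => by ring
  rw [h5]
  exact neg_mem h4

end RankOne

section Gradings

open MvPolynomial

variable {K : Type*} [Field K] {V : Type*}

open scoped Classical in
/-- The grading in which the variables of `S` have degree one and all others degree zero, written
as the homomorphism that multiplies the variables of `S` by a new variable. -/
noncomputable def scaleHom (S : Set (TreeVar V)) :
    MvPolynomial (TreeVar V) K →ₐ[K] Polynomial (MvPolynomial (TreeVar V) K) :=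
  aeval fun i => if i ∈ S then Polynomial.C (X i) * Polynomial.X else Polynomial.C (X i)

/-- The constant polynomials, as a homomorphism of `K`-algebras. -/
noncomputable abbrev constHom :
    MvPolynomial (TreeVar V) K →ₐ[K] Polynomial (MvPolynomial (TreeVar V) K) :=
  Polynomial.CAlgHom

theorem eval_scaleHom (S : Set (TreeVar V)) (f : MvPolynomial (TreeVar V) K) :
    (scaleHom S f).eval 1 = f := by
  have : ((Polynomial.aeval (R := MvPolynomial (TreeVar V) K) (1 : MvPolynomial (TreeVar V) K)
      ).restrictScalars K).comp (scaleHom S) = AlgHom.id K _ := by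
    refine MvPolynomial.algHom_ext fun i => ?_
    by_cases hi : i ∈ S <;> simp [scaleHom, aeval_X, hi]
  have h := DFunLike.congr_fun this f
  simpa [Polynomial.aeval_def] using h

theorem scaleHom_X_of_mem {S : Set (TreeVar V)} {i : TreeVar V} (hi : i ∈ S) :
    scaleHom (K := K) S (X i) = Polynomial.C (X i) * Polynomial.X := by
  simp [scaleHom, aeval_X, hi]

theorem scaleHom_X_of_notMem {S : Set (TreeVar V)} {i : TreeVar V} (hi : i ∉ S) :
    scaleHom (K := K) S (X i) = Polynomial.C (X i) := by
  simp [scaleHom, aeval_X, hi]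

/-- The variables `y_v` and `T_(u,v)` attached to `C`. -/
def scaledVars (C : Set V) : Set (TreeVar V) :=
  {i | i ∈ varsOn C ∧ i.isRight}

theorem scaleHom_xVar (C : Set V) (v : V) :
    scaleHom (scaledVars C) (xVar K v) = Polynomial.C (xVar K v) :=
  scaleHom_X_of_notMem fun h => by simpa using h.2

theorem scaleHom_yVar {C : Set V} {v : V} (hv : v ∈ C) :
    scaleHom (scaledVars C) (yVar K v) = Polynomial.C (yVar K v) * Polynomial.X :=
  scaleHom_X_of_mem ⟨hv, rfl⟩

theorem scaleHom_yVar_of_notMem {C : Set V} {v : V} (hv : v ∉ C) :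
    scaleHom (scaledVars C) (yVar K v) = Polynomial.C (yVar K v) :=
  scaleHom_X_of_notMem fun h => hv h.1

theorem scaleHom_edgeSymbol {C : Set V} {u v : V} (hu : u ∈ C) (hv : v ∈ C) :
    scaleHom (scaledVars C) (edgeSymbol K u v) =
      Polynomial.C (edgeSymbol K u v) * Polynomial.X := by
  have h₁ : Sum.inr (Sum.inr (u, v)) ∈ scaledVars C := ⟨⟨hu, hv⟩, rfl⟩
  have h₂ : Sum.inr (Sum.inr (v, u)) ∈ scaledVars C := ⟨⟨hv, hu⟩, rfl⟩
  rw [edgeSymbol, map_sub, scaleHom_X_of_mem h₁, scaleHom_X_of_mem h₂, Polynomial.C_sub, sub_mul]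

theorem scaleHom_minor {C : Set V} {u v : V} (hu : u ∈ C) (hv : v ∈ C) :
    scaleHom (scaledVars C) (minor K u v) = Polynomial.C (minor K u v) * Polynomial.X := by
  simp only [minor, map_sub, map_mul, scaleHom_xVar, scaleHom_yVar hu, scaleHom_yVar hv]
  ring

theorem scaleHom_plucker {C : Set V} {w a b c : V} (hw : w ∈ C) (ha : a ∈ C) (hb : b ∈ C)
    (hc : c ∈ C) : scaleHom (scaledVars C) (plucker K w a b c) =
      Polynomial.C (plucker K w a b c) * Polynomial.X ^ 2 := by
  simp only [plucker, map_sub, map_add, map_mul, scaleHom_minor, scaleHom_edgeSymbol, ha, hb, hc,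
    hw]
  ring

theorem scaleHom_mem_of_generatedOn {C : Set V} {I : Ideal (MvPolynomial (TreeVar V) K)}
    (hI : GeneratedOn (varsOn Cᶜ) I) : I ≤ (I.map Polynomial.C).comap (scaleHom (scaledVars C)) :=
  fun a ha => hI.map_le (φ := scaleHom (scaledVars C)) (ψ := constHom) (fun _ hi =>
    scaleHom_X_of_notMem fun h =>
      Set.disjoint_left.mp (disjoint_varsOn_compl C) h.1 hi) a ha

theorem scaleHom_mem_markedIdeal {G : SimpleGraph V} {C : Set V}
    (h : ∀ u v, G.Adj u v → u ∈ C ∧ v ∈ C) (p : V) :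
    markedIdeal K G p ≤ ((markedIdeal K G p).map Polynomial.C).comap
      (scaleHom (scaledVars C)) := by
  refine sup_le (gradedIdeal_le ?_ ?_) (cliqueIdeal_le ?_)
  · intro u v huv
    rw [Ideal.mem_comap, scaleHom_minor (h _ _ huv).1 (h _ _ huv).2]
    exact Ideal.mul_mem_right _ _ (Ideal.mem_map_of_mem _
      (Ideal.mem_sup_left (minor_mem_gradedIdeal huv)))
  · intro w a b c ha hb hc
    rw [Ideal.mem_comap, scaleHom_plucker (h _ _ ha).1 (h _ _ ha).2 (h _ _ hb).2 (h _ _ hc).2]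
    exact Ideal.mul_mem_right _ _ (Ideal.mem_map_of_mem _
      (Ideal.mem_sup_left (plucker_mem_gradedIdeal ha hb hc)))
  · intro a b ha hb
    rw [Ideal.mem_comap, scaleHom_minor (h _ _ ha).2 (h _ _ hb).2]
    exact Ideal.mul_mem_right _ _ (Ideal.mem_map_of_mem _
      (Ideal.mem_sup_right (minor_mem_cliqueIdeal ha hb)))

open scoped Classical in
/-- The homomorphism that replaces the edge symbol of `(a, p)` by a new variable. -/
noncomputable def symbolHom (a p : V) :
    MvPolynomial (TreeVar V) K →ₐ[K] Polynomial (MvPolynomial (TreeVar V) K) :=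
  aeval fun i => if i = Sum.inr (Sum.inr (a, p)) then
    Polynomial.X + Polynomial.C (X (Sum.inr (Sum.inr (p, a)))) else Polynomial.C (X i)

theorem eval_symbolHom (a p : V) (f : MvPolynomial (TreeVar V) K) :
    (symbolHom a p f).eval (edgeSymbol K a p) = f := by
  have : ((Polynomial.aeval (R := MvPolynomial (TreeVar V) K) (edgeSymbol K a p)
      ).restrictScalars K).comp (symbolHom a p) = AlgHom.id K _ := by
    refine MvPolynomial.algHom_ext fun i => ?_
    by_cases hi : i = Sum.inr (Sum.inr (a, p)) <;> simp [symbolHom, aeval_X, hi, edgeSymbol]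
  have h := DFunLike.congr_fun this f
  simpa [Polynomial.aeval_def] using h

theorem symbolHom_edgeSymbol {a p : V} (h : a ≠ p) :
    symbolHom a p (edgeSymbol K a p) = Polynomial.X := by
  have : (p, a) ≠ (a, p) := fun h' => h (Prod.ext_iff.mp h').2
  simp [symbolHom, edgeSymbol, aeval_X, this]

theorem symbolHom_of_mem_supported {a p : V} {f : MvPolynomial (TreeVar V) K}
    (hf : f ∈ supported K {Sum.inr (Sum.inr (a, p))}ᶜ) : symbolHom a p f = Polynomial.C f := by
  refine algHom_eq_of_mem_supported (ψ := constHom) (fun i hi => ?_) hf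
  have : i ≠ Sum.inr (Sum.inr (a, p)) := hi
  simp [symbolHom, aeval_X, this, Polynomial.CAlgHom_apply]

theorem symbolHom_mem_of_generatedOn {a p : V} {I : Ideal (MvPolynomial (TreeVar V) K)}
    (hI : GeneratedOn {Sum.inr (Sum.inr (a, p))}ᶜ I) :
    ∀ f ∈ I, symbolHom a p f ∈ I.map Polynomial.C :=
  hI.map_le (φ := symbolHom a p) (ψ := constHom) (fun i hi => by
    have : i ≠ Sum.inr (Sum.inr (a, p)) := hi
    simp [symbolHom, aeval_X, this, Polynomial.CAlgHom_apply])

theorem minor_mem_supported_compl (a p u v : V) :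
    minor K u v ∈ supported K ({Sum.inr (Sum.inr (a, p))}ᶜ : Set (TreeVar V)) :=
  sub_mem (mul_mem (xVar_mem_supported (by simp)) (yVar_mem_supported (by simp)))
    (mul_mem (xVar_mem_supported (by simp)) (yVar_mem_supported (by simp)))

theorem edgeSymbol_mem_supported_compl {a p u v : V} (h : s(u, v) ≠ s(a, p)) :
    edgeSymbol K u v ∈ supported K ({Sum.inr (Sum.inr (a, p))}ᶜ : Set (TreeVar V)) := by
  have h1 : ¬ (u = a ∧ v = p) := fun h' => h (Sym2.eq_iff.mpr (Or.inl h'))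
  have h2 : ¬ (v = a ∧ u = p) := fun h' => h (Sym2.eq_iff.mpr (Or.inr ⟨h'.2, h'.1⟩))
  exact sub_mem (X_mem_supported.mpr (by simpa using h1)) (X_mem_supported.mpr (by simpa using h2))

/-- The relation `plucker a c c' p` is linear in `edgeSymbol a p`, with leading coefficient
`minor c c'`. -/
theorem symbolHom_plucker {a p c c' : V} (hp : a ≠ p) (hc : c ≠ p) (hc' : c' ≠ p) :
    symbolHom a p (plucker K a c c' p) = Polynomial.C (minor K c c') * Polynomial.X +
      Polynomial.C (minor K c' p * edgeSymbol K a c - minor K c p * edgeSymbol K a c') := by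
  have key : ∀ b, b ≠ p → s(a, b) ≠ s(a, p) := by
    intro b hb h
    rcases Sym2.eq_iff.mp h with h | h
    exacts [hb h.2, hp h.1]
  have h1 := symbolHom_of_mem_supported (K := K) (edgeSymbol_mem_supported_compl (key c hc))
  have h2 := symbolHom_of_mem_supported (K := K) (edgeSymbol_mem_supported_compl (key c' hc'))
  simp only [plucker, map_add, map_sub, map_mul, symbolHom_edgeSymbol hp, h1, h2,
    symbolHom_of_mem_supported (minor_mem_supported_compl a p _ _)]
  ring

theorem varsOn_subset_compl {C : Set V} {a p : V} (h : ¬ (a ∈ C ∧ p ∈ C)) :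
    varsOn C ⊆ ({Sum.inr (Sum.inr (a, p))}ᶜ : Set (TreeVar V)) := by
  rintro i hi rfl
  exact h hi

end Gradings

/-! ### Gluing the graded ideals along an edge -/

section MarkedStep

open MvPolynomial

variable {K : Type*} [Field K] {V : Type*} {G G₁ G₂ : SimpleGraph V} {C : Set V} {p a : V}

theorem cliqueIdeal_eq_span_range (G : SimpleGraph V) (p : V) :
    cliqueIdeal K G p = Ideal.span (Set.range fun i : {c // G.Adj p c} × {c // G.Adj p c} =>
      minor K i.1.1 i.2.1) := by
  rw [cliqueIdeal]
  congr 1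
  ext f
  constructor
  · rintro ⟨b, c, hb, hc, rfl⟩
    exact ⟨(⟨b, hb⟩, ⟨c, hc⟩), rfl⟩
  · rintro ⟨i, rfl⟩
    exact ⟨_, _, i.1.2, i.2.2, rfl⟩

/-- The minors of the column of `a` with the columns of the closed neighbourhood of `p`. -/
noncomputable def edgeMinors (K : Type*) [Field K] (G₁ : SimpleGraph V) (p a : V) :
    {b // b = p ∨ G₁.Adj p b} → MvPolynomial (TreeVar V) K :=
  fun b => minor K a b.1

/-- The Plücker relations at `a` in which the edge `a p` takes part. -/
noncomputable def edgePluckers (K : Type*) [Field K] (G₂ : SimpleGraph V) (p a : V) :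
    {c // G₂.Adj a c} × {c // G₂.Adj a c} → MvPolynomial (TreeVar V) K :=
  fun i => plucker K a i.1.1 i.2.1 p

theorem EdgeSplit.adj (s : EdgeSplit G G₁ G₂ C p a) : G.Adj p a := s.adj_root_iff.mpr (Or.inr rfl)

theorem EdgeSplit.ne (s : EdgeSplit G G₁ G₂ C p a) : a ≠ p := fun h => s.notMem (h ▸ s.mem)

/-- The Plücker relations are alternating, so an extra neighbour `z` may be put last. -/
theorem plucker_mem_of_neighbors {I : Ideal (MvPolynomial (TreeVar V) K)} {w z : V} {N : V → Prop}
    (h₀ : ∀ b c d, N b → N c → N d → plucker K w b c d ∈ I)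
    (h₁ : ∀ b c, N b → N c → plucker K w b c z ∈ I) {b c d : V} (hb : N b ∨ b = z)
    (hc : N c ∨ c = z) (hd : N d ∨ d = z) : plucker K w b c d ∈ I := by
  have swap₁ : ∀ b c d : V, plucker K w c b d = -plucker K w b c d := fun b c d => by
    simp only [plucker, minor]; ring
  have swap₂ : ∀ b c d : V, plucker K w b d c = -plucker K w b c d := fun b c d => by
    simp only [plucker, minor]; ring
  have zero : ∀ b c : V, plucker K w b c c = 0 := fun b c => by
    simp only [plucker, minor]; ring
  rcases hb with hb | rfl <;> rcases hc with hc | rfl <;> rcases hd with hd | rfl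
  · exact h₀ _ _ _ hb hc hd
  · exact h₁ _ _ hb hc
  · rw [swap₂]; exact neg_mem (h₁ _ _ hb hd)
  · rw [zero]; exact I.zero_mem
  · rw [swap₁, swap₂, neg_neg]; exact h₁ _ _ hc hd
  · rw [swap₁, zero, neg_zero]; exact I.zero_mem
  · rw [swap₂, swap₁, zero, neg_zero, neg_zero]; exact I.zero_mem
  · rw [zero]; exact I.zero_mem

/-- A Plücker relation of `G` comes from `G₁` or `G₂`, or involves the edge `p a`. -/
theorem EdgeSplit.gradedIdeal_le (s : EdgeSplit G G₁ G₂ C p a)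
    {I : Ideal (MvPolynomial (TreeVar V) K)} (h₁ : gradedIdeal K G₁ ≤ I)
    (h₂ : gradedIdeal K G₂ ≤ I) (hpa : minor K a p ∈ I)
    (ha : ∀ i, edgePluckers K G₂ p a i ∈ I)
    (hp : ∀ b c d, G.Adj p b → G.Adj p c → G.Adj p d → plucker K p b c d ∈ I) :
    gradedIdeal K G ≤ I := by
  refine BinomialEdge.gradedIdeal_le ?_ ?_
  · intro u v huv
    rcases (s.adj_iff _ _).mp huv with h | h | ⟨rfl, rfl⟩ | ⟨rfl, rfl⟩
    · exact h₁ (minor_mem_gradedIdeal h)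
    · exact h₂ (minor_mem_gradedIdeal h)
    · rw [minor_swap]; exact neg_mem hpa
    · exact hpa
  · intro w b c d hb hc hd
    by_cases hwp : w = p
    · subst hwp; exact hp b c d hb hc hd
    by_cases hwa : w = a
    · subst hwa
      rw [s.adj_branch_iff] at hb hc hd
      refine plucker_mem_of_neighbors (N := G₂.Adj w) (fun b c d hb hc hd =>
        h₂ (plucker_mem_gradedIdeal hb hc hd)) (fun b c hb hc => ha (⟨b, hb⟩, ⟨c, hc⟩)) hb hc hd
    by_cases hw : w ∈ C
    · exact h₁ (plucker_mem_gradedIdeal (s.adj_of_mem hw hwp hb) (s.adj_of_mem hw hwp hc)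
        (s.adj_of_mem hw hwp hd))
    · exact h₂ (plucker_mem_gradedIdeal (s.adj_of_notMem hw hwa hb) (s.adj_of_notMem hw hwa hc)
        (s.adj_of_notMem hw hwa hd))

theorem EdgeSplit.edgePluckers_mem (s : EdgeSplit G G₁ G₂ C p a)
    (i : {c // G₂.Adj a c} × {c // G₂.Adj a c}) : edgePluckers K G₂ p a i ∈ gradedIdeal K G :=
  plucker_mem_gradedIdeal (s.right_le i.1.2) (s.right_le i.2.2) s.adj.symm

theorem EdgeSplit.edgeMinors_mem (s : EdgeSplit G G₁ G₂ C p a) (b : {b // b = p ∨ G₁.Adj p b}) :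
    edgeMinors K G₁ p a b ∈ markedIdeal K G p := by
  obtain ⟨b, rfl | hb⟩ := b
  · exact Ideal.mem_sup_left (minor_mem_gradedIdeal s.adj.symm)
  · exact Ideal.mem_sup_right (minor_mem_cliqueIdeal s.adj (s.left_le hb))

theorem EdgeSplit.markedIdeal_eq (s : EdgeSplit G G₁ G₂ C p a) :
    markedIdeal K G p = markedIdeal K G₁ p ⊔ gradedIdeal K G₂ ⊔
      Ideal.span (Set.range (edgeMinors K G₁ p a)) ⊔
      Ideal.span (Set.range (edgePluckers K G₂ p a)) := by
  apply le_antisymm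
  · set I := markedIdeal K G₁ p ⊔ gradedIdeal K G₂ ⊔
      Ideal.span (Set.range (edgeMinors K G₁ p a)) ⊔
      Ideal.span (Set.range (edgePluckers K G₂ p a)) with hI
    have h₁ : markedIdeal K G₁ p ≤ I := le_sup_left.trans (le_sup_left.trans le_sup_left)
    have h₂ : gradedIdeal K G₂ ≤ I := le_sup_right.trans (le_sup_left.trans le_sup_left)
    have hm : ∀ b, edgeMinors K G₁ p a b ∈ I := fun b =>
      Ideal.mem_sup_left (Ideal.mem_sup_right (Ideal.subset_span ⟨b, rfl⟩))
    have hc : ∀ b c, G.Adj p b → G.Adj p c → minor K b c ∈ I := by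
      intro b c hb hc
      rcases s.adj_root_iff.mp hb with hb | rfl <;> rcases s.adj_root_iff.mp hc with hc | rfl
      · exact h₁ (Ideal.mem_sup_right (minor_mem_cliqueIdeal hb hc))
      · rw [minor_swap]; exact neg_mem (hm ⟨b, Or.inr hb⟩)
      · exact hm ⟨c, Or.inr hc⟩
      · rw [minor_self]; exact I.zero_mem
    refine sup_le (s.gradedIdeal_le (le_sup_left.trans h₁) h₂ (hm ⟨p, Or.inl rfl⟩)
      (fun i => Ideal.mem_sup_right (Ideal.subset_span ⟨i, rfl⟩)) ?_) (cliqueIdeal_le hc)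
    intro b c d hb hc' hd
    exact plucker_mem_of_minor_mem p (hc b c hb hc') (hc b d hb hd) (hc c d hc' hd)
  · refine sup_le (sup_le (sup_le (markedIdeal_mono s.left_le p)
      ((gradedIdeal_mono s.right_le).trans le_sup_left)) (Ideal.span_le.mpr ?_))
      (Ideal.span_le.mpr ?_)
    · rintro _ ⟨b, rfl⟩
      exact s.edgeMinors_mem b
    · rintro _ ⟨i, rfl⟩
      exact Ideal.mem_sup_left (s.edgePluckers_mem i)

theorem EdgeSplit.markedIdeal_sup_yIdeal_eq (s : EdgeSplit G G₁ G₂ C p a) :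
    markedIdeal K G p ⊔ yIdeal K G p = (markedIdeal K G₁ p ⊔ yIdeal K G₁ p) ⊔
      (gradedIdeal K G₂ ⊔ Ideal.span {yVar K a}) ⊔
      Ideal.span (Set.range (edgePluckers K G₂ p a)) := by
  apply le_antisymm
  · set I := (markedIdeal K G₁ p ⊔ yIdeal K G₁ p) ⊔
      (gradedIdeal K G₂ ⊔ Ideal.span {yVar K a}) ⊔
      Ideal.span (Set.range (edgePluckers K G₂ p a)) with hI
    have h₁ : markedIdeal K G₁ p ⊔ yIdeal K G₁ p ≤ I := le_sup_left.trans le_sup_left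
    have h₂ : gradedIdeal K G₂ ⊔ Ideal.span {yVar K a} ≤ I := le_sup_right.trans le_sup_left
    have hy : ∀ b, b = p ∨ G.Adj p b → yVar K b ∈ I := by
      intro b hb
      rw [s.adj_root_iff, ← or_assoc] at hb
      rcases hb with hb | rfl
      · exact h₁ (Ideal.mem_sup_right (Ideal.subset_span ⟨⟨b, hb⟩, rfl⟩))
      · exact h₂ (Ideal.mem_sup_right (Ideal.mem_span_singleton_self _))
    have hm : ∀ b c, yVar K b ∈ I → yVar K c ∈ I → minor K b c ∈ I := fun b c hb hc =>
      Ideal.sub_mem _ (Ideal.mul_mem_left _ _ hc) (Ideal.mul_mem_left _ _ hb)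
    have hc : ∀ b c, G.Adj p b → G.Adj p c → minor K b c ∈ I := fun b c hb hc =>
      hm b c (hy b (Or.inr hb)) (hy c (Or.inr hc))
    refine sup_le (sup_le (s.gradedIdeal_le ((le_sup_left.trans le_sup_left).trans h₁)
      (le_sup_left.trans h₂) (hm a p (hy a (Or.inr s.adj)) (hy p (Or.inl rfl)))
      (fun i => Ideal.mem_sup_right (Ideal.subset_span ⟨i, rfl⟩)) ?_) (cliqueIdeal_le hc))
      (Ideal.span_le.mpr ?_)
    · intro b c d hb hc' hd
      exact plucker_mem_of_minor_mem p (hc b c hb hc') (hc b d hb hd) (hc c d hc' hd)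
    · rintro _ ⟨b, rfl⟩
      exact hy b.1 b.2
  · refine sup_le (sup_le (sup_le ((markedIdeal_mono s.left_le p).trans le_sup_left)
      (Ideal.span_le.mpr ?_)) (sup_le ((gradedIdeal_mono s.right_le).trans
      (le_sup_left.trans le_sup_left)) ?_)) (Ideal.span_le.mpr ?_)
    · rintro _ ⟨b, rfl⟩
      exact Ideal.mem_sup_right (Ideal.subset_span ⟨⟨b.1, b.2.imp_right fun h => s.left_le h⟩, rfl⟩)
    · rw [Ideal.span_singleton_le_iff_mem]
      exact Ideal.mem_sup_right (Ideal.subset_span ⟨⟨a, Or.inr s.adj⟩, rfl⟩)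
    · rintro _ ⟨i, rfl⟩
      exact Ideal.mem_sup_left (Ideal.mem_sup_left (s.edgePluckers_mem i))

theorem scaleHom_edgeMinors (s : EdgeSplit G G₁ G₂ C p a) (b : {b // b = p ∨ G₁.Adj p b}) :
    scaleHom (scaledVars C) (edgeMinors K G₁ p a b) =
      Polynomial.C (yVar K b.1 * xVar K a) * Polynomial.X +
        Polynomial.C (-(xVar K b.1 * yVar K a)) := by
  have hb : b.1 ∈ C := by
    rcases b with ⟨b, rfl | hb⟩
    exacts [s.mem, (s.left _ _ hb).2]
  simp only [edgeMinors, minor, map_sub, map_mul, scaleHom_xVar, scaleHom_yVar hb,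
    scaleHom_yVar_of_notMem s.notMem, Polynomial.C_neg]
  ring

theorem yVar_mul_xVar_sub_mem (b : {b // b = p ∨ G₁.Adj p b}) :
    yVar K p * xVar K b.1 - xVar K p * yVar K b.1 ∈ markedIdeal K G₁ p := by
  have h : yVar K p * xVar K b.1 - xVar K p * yVar K b.1 = -minor K p b.1 := by
    simp only [minor]; ring
  rw [h]
  rcases b with ⟨b, rfl | hb⟩
  · rw [minor_self, neg_zero]; exact Ideal.zero_mem _
  · exact neg_mem (Ideal.mem_sup_left (minor_mem_gradedIdeal hb))

/-- The first half of the gluing: imposing that the column of `a` is proportional to the columns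
of the closed neighbourhood of `p`. Here `J` and `H` are ideals on the side of `a`, such that
`J ⊔ H` is the annihilator of `x_a` modulo `J`. The two assertions are the regularity of `x_p`, and
the fact that combinations of the new minors lie in `markedIdeal K G₁ p ⊔ J ⊔ H` only if they lie
in `markedIdeal K G₁ p ⊔ J`. -/
theorem edgeMinors_regular (s : EdgeSplit G G₁ G₂ C p a) [Fintype {b // b = p ∨ G₁.Adj p b}]
    (hN : RegularMod (markedIdeal K G₁ p) (xVar K p))
    (hNy : RegularMod (markedIdeal K G₁ p ⊔ yIdeal K G₁ p) (xVar K p))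
    {J H : Ideal (MvPolynomial (TreeVar V) K)} (hJ : GeneratedOn (varsOn Cᶜ) J)
    (hH : GeneratedOn (varsOn Cᶜ) H) (hu : RegularMod (J ⊔ H) (xVar K a))
    (hxH : ∀ f ∈ H, xVar K a * f ∈ J) (hyH : ∀ f ∈ H, yVar K a * f ∈ J) :
    RegularMod (markedIdeal K G₁ p ⊔ J ⊔ Ideal.span (Set.range (edgeMinors K G₁ p a)))
      (xVar K p) ∧
    ∀ g : {b // b = p ∨ G₁.Adj p b} → MvPolynomial (TreeVar V) K,
      ∑ b, g b * edgeMinors K G₁ p a b ∈ markedIdeal K G₁ p ⊔ J ⊔ H →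
      ∑ b, g b * edgeMinors K G₁ p a b ∈ markedIdeal K G₁ p ⊔ J := by
  have hd := disjoint_varsOn_compl C
  have hM : GeneratedOn (varsOn C) (markedIdeal K G₁ p) := generatedOn_markedIdeal s.left p
  have hY : GeneratedOn (varsOn C) (yIdeal K G₁ p) := generatedOn_yIdeal s.left s.mem
  have hxp : xVar K p ∈ supported K (varsOn C) := xVar_mem_supported s.mem
  have hyp : yVar K p ∈ supported K (varsOn C) := yVar_mem_supported s.mem
  have hxa : xVar K a ∈ supported K (varsOn Cᶜ) := xVar_mem_supported s.notMem
  have hxaI : GeneratedOn (varsOn Cᶜ) (Ideal.span {xVar K a}) :=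
    generatedOn_span fun f hf => by rw [Set.mem_singleton_iff.mp hf]; exact hxa
  set q := markedIdeal K G₁ p ⊔ J with hq
  have hxq : RegularMod q (xVar K p) := by
    rw [hq, sup_comm]; exact hN.sup_of_disjoint hd.symm hJ hM hxp
  have hxu : RegularMod (q ⊔ Ideal.span {xVar K a}) (xVar K p) := by
    rw [hq, sup_assoc, sup_comm]
    exact hN.sup_of_disjoint hd.symm (hJ.sup hxaI) hM hxp
  have hu' : ∀ k, xVar K a * k ∈ q → k ∈ q ⊔ H := by
    intro k hk
    have h1 : RegularMod (q ⊔ H) (xVar K a) := by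
      rw [hq, sup_assoc]; exact hu.sup_of_disjoint hd hM (hJ.sup hH) hxa
    exact h1 k (Ideal.mem_sup_left hk)
  have hxy : RegularMod (q ⊔ H ⊔ yIdeal K G₁ p) (xVar K p) := by
    have : q ⊔ H ⊔ yIdeal K G₁ p = (J ⊔ H) ⊔ (markedIdeal K G₁ p ⊔ yIdeal K G₁ p) := by
      rw [hq]; ac_rfl
    rw [this]
    exact hNy.sup_of_disjoint hd.symm (hJ.sup hH) (hM.sup hY) hxp
  have hy : RegularMod (q ⊔ H) (yVar K p) := by
    rw [hq, sup_assoc, sup_comm]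
    exact (regularMod_yVar_of_xVar hN).sup_of_disjoint hd.symm (hJ.sup hH) hM hyp
  have hxH' : ∀ f ∈ H, xVar K a * f ∈ q := fun f hf => Ideal.mem_sup_right (hxH f hf)
  have hyH' : ∀ f ∈ H, yVar K a * f ∈ q := fun f hf => Ideal.mem_sup_right (hyH f hf)
  have hsyz := sum_mul_mem_of_proportional (x := xVar K p) hu' hyH' hy
    (fun b => Ideal.mem_sup_left (yVar_mul_xVar_sub_mem b))
  have hδ : ∀ {I : Ideal (MvPolynomial (TreeVar V) K)}, GeneratedOn (varsOn Cᶜ) I →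
      ∀ f ∈ markedIdeal K G₁ p ⊔ I, (scaleHom (K := K) (scaledVars C)).toRingHom f ∈
        (markedIdeal K G₁ p ⊔ I).map Polynomial.C := by
    intro I hI f hf
    have : markedIdeal K G₁ p ⊔ I ≤ ((markedIdeal K G₁ p ⊔ I).map Polynomial.C).comap
        (scaleHom (scaledVars C)) :=
      sup_le ((scaleHom_mem_markedIdeal s.left p).trans
        (Ideal.comap_mono (Ideal.map_mono le_sup_left)))
        ((scaleHom_mem_of_generatedOn hI).trans
          (Ideal.comap_mono (Ideal.map_mono le_sup_right)))
    exact this hf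
  refine ⟨?_, fun g hg => ?_⟩
  · refine regularMod_of_linearIdeal (scaleHom (K := K) (scaledVars C)).toRingHom 1
      (eval_scaleHom _) (hδ hJ) (scaleHom_xVar C p) (scaleHom_edgeMinors s)
      (regularMod_linearIdeal hxq (regularMod_sup_span_mul hxu hu' hxH' hxy) hsyz)
  · refine sum_mem_of_sum_mem (scaleHom (K := K) (scaledVars C)).toRingHom 1 (eval_scaleHom _)
      (q' := q ⊔ H) ?_ (scaleHom_edgeMinors s) le_sup_left ?_ hsyz hg
    · have := hδ (hJ.sup hH)
      rwa [← sup_assoc] at this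
    · intro g hg
      have hsum : ∑ b, g b * (yVar K b.1 * xVar K a) = xVar K a * ∑ b, g b * yVar K b.1 := by
        rw [Finset.mul_sum]; exact Finset.sum_congr rfl fun i _ => by ring
      rw [hsum] at hg ⊢
      have h1 : RegularMod (q ⊔ H) (xVar K a) := by
        rw [hq, sup_assoc]; exact hu.sup_of_disjoint hd hM (hJ.sup hH) hxa
      obtain ⟨v, hv, v', hv', hvv⟩ := Submodule.mem_sup.mp (h1 _ hg)
      rw [← hvv, mul_add]
      exact Ideal.add_mem _ (Ideal.mul_mem_left _ _ hv) (hxH' _ hv')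

/-- The syzygies modulo the graded ideal of the minors of the neighbours of `a`: each comes from a
multiple of the column of `a`. -/
def HasColumnSyzygies (K : Type*) [Field K] (G : SimpleGraph V) (a : V) : Prop :=
  ∀ [Fintype ({c // G.Adj a c} × {c // G.Adj a c})]
    (g : {c // G.Adj a c} × {c // G.Adj a c} → MvPolynomial (TreeVar V) K),
    ∑ i, g i * minor K i.1.1 i.2.1 ∈ gradedIdeal K G → ∃ l,
      ∑ i, g i * (xVar K i.1.1 * edgeSymbol K a i.2.1 - xVar K i.2.1 * edgeSymbol K a i.1.1) -
        xVar K a * l ∈ gradedIdeal K G ∧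
      ∑ i, g i * (yVar K i.1.1 * edgeSymbol K a i.2.1 - yVar K i.2.1 * edgeSymbol K a i.1.1) -
        yVar K a * l ∈ gradedIdeal K G

theorem HasColumnSyzygies.exists_minor (h : HasColumnSyzygies K G a) (p : V)
    [Fintype ({c // G.Adj a c} × {c // G.Adj a c})]
    (g : {c // G.Adj a c} × {c // G.Adj a c} → MvPolynomial (TreeVar V) K)
    (hg : ∑ i, g i * minor K i.1.1 i.2.1 ∈ gradedIdeal K G) : ∃ l,
      ∑ i, g i * (minor K i.2.1 p * edgeSymbol K a i.1.1 - minor K i.1.1 p * edgeSymbol K a i.2.1) +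
        l * minor K a p ∈ gradedIdeal K G := by
  obtain ⟨l, hx, hy⟩ := h g hg
  refine ⟨l, ?_⟩
  have := Ideal.sub_mem _ (Ideal.mul_mem_left _ (xVar K p) hy) (Ideal.mul_mem_left _ (yVar K p) hx)
  have hs : ∑ i, g i * (minor K i.2.1 p * edgeSymbol K a i.1.1 -
      minor K i.1.1 p * edgeSymbol K a i.2.1) =
      xVar K p * ∑ i, g i * (yVar K i.1.1 * edgeSymbol K a i.2.1 -
        yVar K i.2.1 * edgeSymbol K a i.1.1) -
      yVar K p * ∑ i, g i * (xVar K i.1.1 * edgeSymbol K a i.2.1 -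
        xVar K i.2.1 * edgeSymbol K a i.1.1) := by
    simp only [Finset.mul_sum, ← Finset.sum_sub_distrib, minor]
    exact Finset.sum_congr rfl fun i _ => by ring
  rw [hs]
  convert this using 1
  simp only [minor]
  ring

theorem symbolHom_edgePluckers (s : EdgeSplit G G₁ G₂ C p a)
    (i : {c // G₂.Adj a c} × {c // G₂.Adj a c}) :
    symbolHom a p (edgePluckers K G₂ p a i) =
      Polynomial.C (minor K i.1.1 i.2.1) * Polynomial.X +
        Polynomial.C (minor K i.2.1 p * edgeSymbol K a i.1.1 -
          minor K i.1.1 p * edgeSymbol K a i.2.1) := by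
  have key : ∀ c : {c // G₂.Adj a c}, c.1 ≠ p := fun c h => (s.right _ _ c.2).2 (h ▸ s.mem)
  exact symbolHom_plucker s.ne (key _) (key _)

theorem EdgeSplit.varsOn_subset (s : EdgeSplit G G₁ G₂ C p a) :
    varsOn C ⊆ ({Sum.inr (Sum.inr (a, p))}ᶜ : Set (TreeVar V)) :=
  varsOn_subset_compl fun h => s.notMem h.1

theorem EdgeSplit.varsOn_compl_subset (s : EdgeSplit G G₁ G₂ C p a) :
    varsOn Cᶜ ⊆ ({Sum.inr (Sum.inr (a, p))}ᶜ : Set (TreeVar V)) :=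
  varsOn_subset_compl fun h => h.2 s.mem

/-- Gluing: if `x_p` and `x_a` are regular on their sides, `x_p` stays regular after joining the
two sides by the edge `p a`. -/
theorem EdgeSplit.regularMod_markedIdeal [Finite V] (s : EdgeSplit G G₁ G₂ C p a)
    (hN : RegularMod (markedIdeal K G₁ p) (xVar K p))
    (hNy : RegularMod (markedIdeal K G₁ p ⊔ yIdeal K G₁ p) (xVar K p))
    (hN₂ : RegularMod (markedIdeal K G₂ a) (xVar K a)) (hS : HasColumnSyzygies K G₂ a) :
    RegularMod (markedIdeal K G p) (xVar K p) := by
  let _ : Fintype {b // b = p ∨ G₁.Adj p b} := Fintype.ofFinite _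
  let _ : Fintype ({c // G₂.Adj a c} × {c // G₂.Adj a c}) := Fintype.ofFinite _
  have hJ : GeneratedOn (varsOn Cᶜ) (gradedIdeal K G₂) := generatedOn_gradedIdeal s.right
  have hH : GeneratedOn (varsOn Cᶜ) (cliqueIdeal K G₂ a) := generatedOn_cliqueIdeal s.right a
  have hM : GeneratedOn (varsOn C) (markedIdeal K G₁ p) := generatedOn_markedIdeal s.left p
  obtain ⟨hreg, hinter⟩ := edgeMinors_regular s hN hNy hJ hH hN₂
    (fun f hf => xVar_mul_cliqueIdeal hf) (fun f hf => yVar_mul_cliqueIdeal hf)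
  have hreg' := (edgeMinors_regular s hN hNy (hJ.sup hH)
    (H := ⊥) ⟨∅, by simp, by simp⟩ (by rwa [sup_bot_eq])
    (fun f hf => by rw [Ideal.mem_bot.mp hf, mul_zero]; exact Ideal.zero_mem _)
    (fun f hf => by rw [Ideal.mem_bot.mp hf, mul_zero]; exact Ideal.zero_mem _)).1
  rw [s.markedIdeal_eq]
  set q₀ := markedIdeal K G₁ p ⊔ gradedIdeal K G₂ with hq₀
  set q := q₀ ⊔ Ideal.span (Set.range (edgeMinors K G₁ p a)) with hq
  have hE : GeneratedOn ({Sum.inr (Sum.inr (a, p))}ᶜ : Set (TreeVar V))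
      (Ideal.span (Set.range (edgeMinors K G₁ p a))) := by
    refine generatedOn_span ?_
    rintro _ ⟨b, rfl⟩
    exact minor_mem_supported_compl a p a b.1
  refine regularMod_of_linearIdeal (symbolHom (K := K) a p).toRingHom (edgeSymbol K a p)
    (eval_symbolHom a p) (symbolHom_mem_of_generatedOn
      (((hM.mono s.varsOn_subset).sup (hJ.mono s.varsOn_compl_subset)).sup hE))
    (symbolHom_of_mem_supported (xVar_mem_supported (by simp))) (symbolHom_edgePluckers s)
    (regularMod_linearIdeal hreg ?_ ?_)
  · rw [← cliqueIdeal_eq_span_range]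
    convert hreg' using 1
    rw [hq, hq₀]
    ac_rfl
  · intro g hg
    have h0 : ∑ i, g i * minor K i.1.1 i.2.1 ∈ q₀ := by
      obtain ⟨c, hc⟩ := exists_sum_of_mem_sup_span hg
      have h1 : ∑ i, g i * minor K i.1.1 i.2.1 ∈ q₀ ⊔ cliqueIdeal K G₂ a :=
        Ideal.mem_sup_right (Ideal.sum_mem _ fun i _ => Ideal.mul_mem_left _ _
          (minor_mem_cliqueIdeal i.1.2 i.2.2))
      have h2 : ∑ b, c b * edgeMinors K G₁ p a b ∈ q₀ ⊔ cliqueIdeal K G₂ a := by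
        have := Ideal.sub_mem _ h1 (Ideal.mem_sup_left hc)
        rwa [sub_sub_cancel] at this
      have := Ideal.add_mem _ hc (hinter c h2)
      rwa [sub_add_cancel] at this
    obtain ⟨b, hb, hgb⟩ := exists_syzygy_of_disjoint (disjoint_varsOn_compl C) hM hJ
      (fun i => minor_mem_supported (s.right _ _ i.1.2).2 (s.right _ _ i.2.2).2) h0
    obtain ⟨l, hl⟩ := hS.exists_minor p b hb
    have h3 : l * minor K a p ∈ q := Ideal.mem_sup_right (Ideal.mul_mem_left _ _
      (Ideal.subset_span ⟨⟨p, Or.inl rfl⟩, rfl⟩))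
    have h4 := Ideal.sub_mem _ (Ideal.mem_sup_left (Ideal.mem_sup_right hl) : _ ∈ q) h3
    rw [add_sub_cancel_right] at h4
    have h5 : ∑ i, (g i - b i) * (minor K i.2.1 p * edgeSymbol K a i.1.1 -
        minor K i.1.1 p * edgeSymbol K a i.2.1) ∈ q :=
      Ideal.sum_mem _ fun i _ => Ideal.mul_mem_right _ _ (Ideal.mem_sup_left (hgb i))
    have := Ideal.add_mem _ h5 h4
    simpa only [sub_mul, Finset.sum_sub_distrib, sub_add_cancel] using this

/-- Gluing modulo the variables `y_b` of the closed neighbourhood of `p`. -/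
theorem EdgeSplit.regularMod_markedIdeal_sup_yIdeal [Finite V] (s : EdgeSplit G G₁ G₂ C p a)
    (hNy : RegularMod (markedIdeal K G₁ p ⊔ yIdeal K G₁ p) (xVar K p))
    (hN₂ : RegularMod (markedIdeal K G₂ a) (xVar K a)) (hS : HasColumnSyzygies K G₂ a) :
    RegularMod (markedIdeal K G p ⊔ yIdeal K G p) (xVar K p) := by
  let _ : Fintype ({c // G₂.Adj a c} × {c // G₂.Adj a c}) := Fintype.ofFinite _
  have hd := disjoint_varsOn_compl C
  have hJ : GeneratedOn (varsOn Cᶜ) (gradedIdeal K G₂) := generatedOn_gradedIdeal s.right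
  have hH : GeneratedOn (varsOn Cᶜ) (cliqueIdeal K G₂ a) := generatedOn_cliqueIdeal s.right a
  have hya : GeneratedOn (varsOn Cᶜ) (Ideal.span {yVar K a}) :=
    generatedOn_span fun f hf => by
      rw [Set.mem_singleton_iff.mp hf]; exact yVar_mem_supported s.notMem
  have hM : GeneratedOn (varsOn C) (markedIdeal K G₁ p ⊔ yIdeal K G₁ p) :=
    (generatedOn_markedIdeal s.left p).sup (generatedOn_yIdeal s.left s.mem)
  have hxp : xVar K p ∈ supported K (varsOn C) := xVar_mem_supported s.mem
  rw [s.markedIdeal_sup_yIdeal_eq]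
  set q := (markedIdeal K G₁ p ⊔ yIdeal K G₁ p) ⊔ (gradedIdeal K G₂ ⊔ Ideal.span {yVar K a})
    with hq
  refine regularMod_of_linearIdeal (symbolHom (K := K) a p).toRingHom (edgeSymbol K a p)
    (eval_symbolHom a p) (symbolHom_mem_of_generatedOn
      ((hM.mono s.varsOn_subset).sup ((hJ.sup hya).mono s.varsOn_compl_subset)))
    (symbolHom_of_mem_supported (xVar_mem_supported (by simp))) (symbolHom_edgePluckers s)
    (regularMod_linearIdeal ?_ ?_ ?_)
  · rw [hq, sup_comm]
    exact hNy.sup_of_disjoint hd.symm (hJ.sup hya) hM hxp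
  · rw [← cliqueIdeal_eq_span_range, hq, sup_assoc, sup_comm]
    exact hNy.sup_of_disjoint hd.symm ((hJ.sup hya).sup hH) hM hxp
  · intro g hg
    obtain ⟨b, hb, hgb⟩ := exists_syzygy_of_disjoint hd hM (hJ.sup hya)
      (fun i => minor_mem_supported (s.right _ _ i.1.2).2 (s.right _ _ i.2.2).2) hg
    -- The multiple of `y_a` occurring here lies in the clique ideal, which `y_a` annihilates.
    have hb' : ∑ i, b i * minor K i.1.1 i.2.1 ∈ gradedIdeal K G₂ := by
      obtain ⟨m, hm, f', hf', hmf⟩ := Submodule.mem_sup.mp hb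
      obtain ⟨f, rfl⟩ := Ideal.mem_span_singleton'.mp hf'
      have h1 : ∑ i, b i * minor K i.1.1 i.2.1 ∈ markedIdeal K G₂ a :=
        Ideal.mem_sup_right (Ideal.sum_mem _ fun i _ => Ideal.mul_mem_left _ _
          (minor_mem_cliqueIdeal i.1.2 i.2.2))
      have h2 : yVar K a * f ∈ markedIdeal K G₂ a := by
        have := Ideal.sub_mem _ h1 (Ideal.mem_sup_left hm)
        rwa [← hmf, add_sub_cancel_left, mul_comm] at this
      obtain ⟨v, hv, v', hv', hvv⟩ := Submodule.mem_sup.mp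
        (regularMod_yVar_of_xVar hN₂ _ h2)
      rw [← hmf, ← hvv, add_mul, mul_comm v']
      exact Ideal.add_mem _ hm (Ideal.add_mem _ (Ideal.mul_mem_right _ _ hv)
        (yVar_mul_cliqueIdeal hv'))
    obtain ⟨l, hl⟩ := hS.exists_minor p b hb'
    have hyp : yVar K p ∈ q := Ideal.mem_sup_left (Ideal.mem_sup_right
      (Ideal.subset_span ⟨⟨p, Or.inl rfl⟩, rfl⟩))
    have hya' : yVar K a ∈ q :=
      Ideal.mem_sup_right (Ideal.mem_sup_right (Ideal.mem_span_singleton_self _))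
    have h3 : l * minor K a p ∈ q := Ideal.mul_mem_left _ _
      (Ideal.sub_mem _ (Ideal.mul_mem_left _ _ hyp) (Ideal.mul_mem_left _ _ hya'))
    have h4 := Ideal.sub_mem _ (Ideal.mem_sup_right (Ideal.mem_sup_left hl) : _ ∈ q) h3
    rw [add_sub_cancel_right] at h4
    have h5 : ∑ i, (g i - b i) * (minor K i.2.1 p * edgeSymbol K a i.1.1 -
        minor K i.1.1 p * edgeSymbol K a i.2.1) ∈ q :=
      Ideal.sum_mem _ fun i _ => Ideal.mul_mem_right _ _ (hgb i)
    have := Ideal.add_mem _ h5 h4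
    simpa only [sub_mul, Finset.sum_sub_distrib, sub_add_cancel] using this

/-- At an isolated vertex `p` the variables `x_p` and `y_p` are free. -/
theorem regularMod_of_isolated (hp : ∀ b, ¬ G.Adj p b) :
    RegularMod (markedIdeal K G p) (xVar K p) ∧
      RegularMod (markedIdeal K G p ⊔ yIdeal K G p) (xVar K p) := by
  have hG : ∀ u v, G.Adj u v → u ∈ ({p}ᶜ : Set V) ∧ v ∈ ({p}ᶜ : Set V) := by
    intro u v huv
    refine ⟨?_, ?_⟩
    · rintro rfl; exact hp _ huv
    · rintro rfl; exact hp _ huv.symm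
  have hgen : GeneratedOn (varsOn ({p}ᶜ : Set V)) (markedIdeal K G p) :=
    generatedOn_markedIdeal hG p
  have hd := (disjoint_varsOn_compl ({p} : Set V)).symm
  have hx : xVar K p ∈ supported K (varsOn ({p} : Set V)) := xVar_mem_supported rfl
  have hx0 : xVar K p ≠ 0 := X_ne_zero _
  constructor
  · have h : RegularMod (⊥ : Ideal (MvPolynomial (TreeVar V) K)) (xVar K p) := fun q hq =>
      (mul_eq_zero.mp hq).resolve_left hx0
    simpa using h.sup_of_disjoint hd hgen ⟨∅, by simp, by simp⟩ hx
  · have hY : yIdeal K G p = Ideal.span {yVar K p} := by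
      rw [yIdeal]
      congr 1
      ext f
      constructor
      · rintro ⟨⟨b, rfl | hb⟩, rfl⟩
        exacts [rfl, absurd hb (hp b)]
      · rintro rfl
        exact ⟨⟨p, Or.inl rfl⟩, rfl⟩
    rw [hY]
    refine RegularMod.sup_of_disjoint hd hgen
      (generatedOn_span (c := varsOn ({p} : Set V)) ?_) hx ?_
    · rintro _ rfl
      exact yVar_mem_supported rfl
    · intro f hf
      rw [Ideal.mem_span_singleton] at hf ⊢
      have hprime : Prime (yVar K p) := MvPolynomial.X_prime
      refine (hprime.dvd_or_dvd hf).resolve_left fun h => ?_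
      have := (MvPolynomial.X_dvd_X (R := K)).mp h
      simp at this

end MarkedStep

/-! ### The extended Rees algebra -/

section Rees

open MvPolynomial

variable {K : Type*} [Field K] {V : Type*} {G G₁ G₂ : SimpleGraph V} {C : Set V} {p a : V}

/-- The presentation ideal of the extended Rees algebra, in the polynomial ring in one more
variable `X` (the inverse of the Rees parameter): each edge minor is `X` times its edge symbol. -/
noncomputable def reesIdeal (K : Type*) [Field K] (G : SimpleGraph V) :
    Ideal (Polynomial (MvPolynomial (TreeVar V) K)) :=
  Ideal.span ({f | ∃ u v, G.Adj u v ∧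
      f = Polynomial.C (minor K u v) - Polynomial.X * Polynomial.C (edgeSymbol K u v)} ∪
    {f | ∃ w a b c, G.Adj w a ∧ G.Adj w b ∧ G.Adj w c ∧ f = Polynomial.C (plucker K w a b c)})

theorem sub_mem_reesIdeal {u v : V} (h : G.Adj u v) :
    Polynomial.C (minor K u v) - Polynomial.X * Polynomial.C (edgeSymbol K u v) ∈
      reesIdeal K G :=
  Ideal.subset_span (Or.inl ⟨u, v, h, rfl⟩)

theorem plucker_mem_reesIdeal {w a b c : V} (ha : G.Adj w a) (hb : G.Adj w b)
    (hc : G.Adj w c) : Polynomial.C (plucker K w a b c) ∈ reesIdeal K G :=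
  Ideal.subset_span (Or.inr ⟨w, a, b, c, ha, hb, hc, rfl⟩)

theorem reesIdeal_le {I : Ideal (Polynomial (MvPolynomial (TreeVar V) K))}
    (h₁ : ∀ u v, G.Adj u v →
      Polynomial.C (minor K u v) - Polynomial.X * Polynomial.C (edgeSymbol K u v) ∈ I)
    (h₂ : ∀ w a b c, G.Adj w a → G.Adj w b → G.Adj w c → Polynomial.C (plucker K w a b c) ∈ I) :
    reesIdeal K G ≤ I := by
  rw [reesIdeal, Ideal.span_le]
  rintro _ (⟨u, v, h, rfl⟩ | ⟨w, a, b, c, ha, hb, hc, rfl⟩)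
  exacts [h₁ u v h, h₂ w a b c ha hb hc]

theorem reesIdeal_mono {G G' : SimpleGraph V} (h : G ≤ G') : reesIdeal K G ≤ reesIdeal K G' :=
  reesIdeal_le (fun _ _ huv => sub_mem_reesIdeal (h huv))
    fun _ _ _ _ ha hb hc => plucker_mem_reesIdeal (h ha) (h hb) (h hc)

theorem eval_zero_mem_gradedIdeal {f : Polynomial (MvPolynomial (TreeVar V) K)}
    (hf : f ∈ reesIdeal K G) : f.eval 0 ∈ gradedIdeal K G := by
  have : reesIdeal K G ≤ (gradedIdeal K G).comap (Polynomial.evalRingHom 0) := by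
    refine reesIdeal_le ?_ ?_
    · intro u v huv
      simpa using minor_mem_gradedIdeal huv
    · intro w a b c ha hb hc
      simpa using plucker_mem_gradedIdeal ha hb hc
  exact this hf

theorem C_mem_of_mem_gradedIdeal {I : Ideal (Polynomial (MvPolynomial (TreeVar V) K))}
    (hI : reesIdeal K G ≤ I) (hX : Polynomial.X ∈ I) {f : MvPolynomial (TreeVar V) K}
    (hf : f ∈ gradedIdeal K G) : Polynomial.C f ∈ I := by
  have : gradedIdeal K G ≤ I.comap Polynomial.C := by
    refine gradedIdeal_le ?_ ?_
    · intro u v huv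
      have := Ideal.add_mem _ (hI (sub_mem_reesIdeal huv))
        (Ideal.mul_mem_right (Polynomial.C (edgeSymbol K u v)) _ hX)
      rwa [sub_add_cancel] at this
    · intro w a b c ha hb hc
      exact hI (plucker_mem_reesIdeal ha hb hc)
  exact this hf

theorem mul_sum_sub_eq_of_syzygy {R ι : Type*} [CommRing R] [Fintype ι]
    {g q u v μ ν σ τ : ι → R} {w l x m : R} (hm : m + l * x = ∑ i, g i * q i)
    (hq : ∀ i, w * q i = u i * ν i - v i * μ i) :
    x * (∑ i, g i * (u i * τ i - v i * σ i) - w * l) =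
      ∑ i, g i * (v i * (μ i - x * σ i) - u i * (ν i - x * τ i)) + w * m := by
  have h : ∑ i, g i * (v i * (μ i - x * σ i) - u i * (ν i - x * τ i)) =
      x * ∑ i, g i * (u i * τ i - v i * σ i) - w * ∑ i, g i * q i := by
    rw [Finset.mul_sum, Finset.mul_sum, ← Finset.sum_sub_distrib]
    refine Finset.sum_congr rfl fun i _ => ?_
    linear_combination g i * hq i
  rw [h, ← hm]
  ring

/-- A combination of the minors that vanishes modulo `X` is `X * l` in the extended Rees algebra.
Multiply this by the entry `x_a` or `y_a` of the column of `a`, expand each product of an entry and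
a minor by Cramer's rule in terms of the minors of edges, which are divisible by `X`, and cancel
`X`. -/
theorem hasColumnSyzygies_of_regularMod (h : RegularMod (reesIdeal K G) Polynomial.X) (a : V) :
    HasColumnSyzygies K G a := by
  intro _ g hg
  obtain ⟨m, hm, m', hm', hmm⟩ := Submodule.mem_sup.mp
    (C_mem_of_mem_gradedIdeal (I := reesIdeal K G ⊔ Ideal.span {Polynomial.X}) le_sup_left
      (Ideal.mem_sup_right (Ideal.mem_span_singleton_self _)) hg)
  obtain ⟨l, rfl⟩ := Ideal.mem_span_singleton'.mp hm'
  simp only [map_sum, Polynomial.C_mul] at hmm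
  have key : ∀ z : V → MvPolynomial (TreeVar V) K,
      (∀ c c', z a * minor K c c' = z c * minor K a c' - z c' * minor K a c) →
      ∑ i, g i * (z i.1.1 * edgeSymbol K a i.2.1 - z i.2.1 * edgeSymbol K a i.1.1) -
        z a * l.eval 0 ∈ gradedIdeal K G := by
    intro z hz
    have hq : ∀ i : {c // G.Adj a c} × {c // G.Adj a c},
        Polynomial.C (z a) * Polynomial.C (minor K i.1.1 i.2.1) =
        Polynomial.C (z i.1.1) * Polynomial.C (minor K a i.2.1) -
          Polynomial.C (z i.2.1) * Polynomial.C (minor K a i.1.1) := fun i => by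
      rw [← Polynomial.C_mul, ← Polynomial.C_mul, ← Polynomial.C_mul, ← Polynomial.C_sub, hz]
    have h1 := h _ (by
      rw [mul_sum_sub_eq_of_syzygy hmm hq (σ := fun i => Polynomial.C (edgeSymbol K a i.1.1))
        (τ := fun i => Polynomial.C (edgeSymbol K a i.2.1))]
      exact Ideal.add_mem _ (Ideal.sum_mem _ fun i _ => Ideal.mul_mem_left _ _ (Ideal.sub_mem _
        (Ideal.mul_mem_left _ _ (sub_mem_reesIdeal i.1.2))
        (Ideal.mul_mem_left _ _ (sub_mem_reesIdeal i.2.2)))) (Ideal.mul_mem_left _ _ hm))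
    have := eval_zero_mem_gradedIdeal h1
    simpa only [Polynomial.eval_sub, Polynomial.eval_mul, Polynomial.eval_C,
      Polynomial.eval_finsetSum] using this
  exact ⟨l.eval 0, key (xVar K) (fun c c' => by simp only [minor]; ring),
    key (yVar K) (fun c c' => by simp only [minor]; ring)⟩

/-- The minor of the new edge is regular modulo the two marked ideals. -/
theorem EdgeSplit.regularMod_minor (s : EdgeSplit G G₁ G₂ C p a)
    (hN : RegularMod (markedIdeal K G₁ p) (xVar K p))
    (hN₂ : RegularMod (markedIdeal K G₂ a) (xVar K a)) :
    RegularMod (markedIdeal K G₁ p ⊔ markedIdeal K G₂ a) (minor K a p) := by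
  have hd := disjoint_varsOn_compl C
  have hM : GeneratedOn (varsOn C) (markedIdeal K G₁ p) := generatedOn_markedIdeal s.left p
  have hM₂ : GeneratedOn (varsOn Cᶜ) (markedIdeal K G₂ a) := generatedOn_markedIdeal s.right a
  have h₁ : RegularMod (markedIdeal K G₁ p ⊔ markedIdeal K G₂ a) (yVar K p) := by
    rw [sup_comm]
    exact (regularMod_yVar_of_xVar hN).sup_of_disjoint hd.symm hM₂ hM (yVar_mem_supported s.mem)
  have h₂ : RegularMod (markedIdeal K G₁ p ⊔ markedIdeal K G₂ a) (xVar K a) :=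
    hN₂.sup_of_disjoint hd hM hM₂ (xVar_mem_supported s.notMem)
  refine regularMod_of_leading (scaleHom (K := K) (scaledVars C)).toRingHom 1 (eval_scaleHom _)
    (fun f hf => ?_) (scaleHom_edgeMinors s ⟨p, Or.inl rfl⟩) (h₁.mul h₂)
  have : markedIdeal K G₁ p ⊔ markedIdeal K G₂ a ≤
      ((markedIdeal K G₁ p ⊔ markedIdeal K G₂ a).map Polynomial.C).comap
        (scaleHom (scaledVars C)) :=
    sup_le ((scaleHom_mem_markedIdeal s.left p).trans
      (Ideal.comap_mono (Ideal.map_mono le_sup_left)))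
      ((scaleHom_mem_of_generatedOn hM₂).trans (Ideal.comap_mono (Ideal.map_mono le_sup_right)))
  exact this hf

/-- The homomorphism `symbolHom a p`, applied to the coefficients. The outer variable of the target
replaces the edge symbol, the inner one is the Rees variable. -/
noncomputable def reesSymbolHom (K : Type*) [Field K] (a p : V) :
    Polynomial (MvPolynomial (TreeVar V) K) →+*
      Polynomial (Polynomial (MvPolynomial (TreeVar V) K)) :=
  Polynomial.eval₂RingHom (S := Polynomial (Polynomial (MvPolynomial (TreeVar V) K)))
    ((Polynomial.mapRingHom (Polynomial.C : MvPolynomial (TreeVar V) K →+* _)).comp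
      (symbolHom (K := K) a p).toRingHom) (Polynomial.C Polynomial.X)

theorem reesSymbolHom_C (f : MvPolynomial (TreeVar V) K) :
    reesSymbolHom K a p (Polynomial.C f) = (symbolHom a p f).map Polynomial.C := by
  simp [reesSymbolHom]

theorem reesSymbolHom_X :
    reesSymbolHom K a p Polynomial.X = Polynomial.C Polynomial.X := by
  simp [reesSymbolHom]

theorem eval_reesSymbolHom (f : Polynomial (MvPolynomial (TreeVar V) K)) :
    (reesSymbolHom K a p f).eval (Polynomial.C (edgeSymbol K a p)) = f := by
  have : (Polynomial.evalRingHom (Polynomial.C (edgeSymbol K a p))).comp (reesSymbolHom K a p) =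
      RingHom.id _ := by
    refine Polynomial.ringHom_ext (fun f => ?_) ?_
    · rw [RingHom.comp_apply, reesSymbolHom_C, Polynomial.coe_evalRingHom, Polynomial.eval_map,
        Polynomial.eval₂_at_apply, eval_symbolHom, RingHom.id_apply]
    · rw [RingHom.comp_apply, reesSymbolHom_X, Polynomial.coe_evalRingHom, Polynomial.eval_C,
        RingHom.id_apply]
  exact DFunLike.congr_fun this f

theorem reesSymbolHom_mem (hap : ¬ G.Adj a p) :
    ∀ f ∈ reesIdeal K G, reesSymbolHom K a p f ∈ (reesIdeal K G).map Polynomial.C := by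
  have hs : ∀ u v, G.Adj u v → symbolHom a p (edgeSymbol K u v) =
      Polynomial.C (edgeSymbol K u v) := by
    intro u v huv
    refine symbolHom_of_mem_supported (edgeSymbol_mem_supported_compl fun h => hap ?_)
    rwa [← SimpleGraph.mem_edgeSet, ← h, SimpleGraph.mem_edgeSet]
  have hm : ∀ u v, symbolHom a p (minor K u v) = Polynomial.C (minor K u v) := fun u v =>
    symbolHom_of_mem_supported (minor_mem_supported_compl a p u v)
  have : reesIdeal K G ≤ ((reesIdeal K G).map Polynomial.C).comap (reesSymbolHom K a p) := by
    refine reesIdeal_le ?_ ?_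
    · intro u v huv
      rw [Ideal.mem_comap, map_sub, map_mul, reesSymbolHom_C, reesSymbolHom_C, reesSymbolHom_X,
        hs u v huv, hm, Polynomial.map_C, Polynomial.map_C, ← Polynomial.C_mul, ← Polynomial.C_sub]
      exact Ideal.mem_map_of_mem _ (sub_mem_reesIdeal huv)
    · intro w b c d hb hc hd
      have : symbolHom a p (plucker K w b c d) = Polynomial.C (plucker K w b c d) := by
        simp only [plucker, map_add, map_sub, map_mul, hm, hs _ _ hb, hs _ _ hc, hs _ _ hd]
      rw [Ideal.mem_comap, reesSymbolHom_C, this, Polynomial.map_C]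
      exact Ideal.mem_map_of_mem _ (plucker_mem_reesIdeal hb hc hd)
  exact fun f hf => this hf

/-- Index type of the relations of the extended Rees algebra in which the edge `p a` takes part. -/
abbrev NewRelation (G₁ G₂ : SimpleGraph V) (p a : V) :=
  Unit ⊕ ({b // G₁.Adj p b} × {b // G₁.Adj p b}) ⊕ ({c // G₂.Adj a c} × {c // G₂.Adj a c})

/-- The relations of the extended Rees algebra in which the edge `p a` takes part. -/
noncomputable def newRelation (K : Type*) [Field K] (G₁ G₂ : SimpleGraph V) (p a : V) :
    NewRelation G₁ G₂ p a → Polynomial (MvPolynomial (TreeVar V) K) :=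
  Sum.elim (fun _ => Polynomial.C (minor K a p) - Polynomial.X * Polynomial.C (edgeSymbol K a p))
    (Sum.elim (fun i => Polynomial.C (plucker K p i.1.1 i.2.1 a))
      fun i => Polynomial.C (plucker K a i.1.1 i.2.1 p))

/-- The coefficient of the edge symbol of `(a, p)` in `newRelation`. -/
noncomputable def newRelationLead (K : Type*) [Field K] (G₁ G₂ : SimpleGraph V) (p a : V) :
    NewRelation G₁ G₂ p a → Polynomial (MvPolynomial (TreeVar V) K) :=
  Sum.elim (fun _ => -Polynomial.X)
    (Sum.elim (fun i => Polynomial.C (-minor K i.1.1 i.2.1))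
      fun i => Polynomial.C (minor K i.1.1 i.2.1))

/-- The part of `newRelation` that is free of the edge symbol of `(a, p)`. -/
noncomputable def newRelationTail (K : Type*) [Field K] (G₁ G₂ : SimpleGraph V) (p a : V) :
    NewRelation G₁ G₂ p a → Polynomial (MvPolynomial (TreeVar V) K) :=
  Sum.elim (fun _ => Polynomial.C (minor K a p))
    (Sum.elim (fun i => Polynomial.C
        (minor K i.2.1 a * edgeSymbol K p i.1.1 - minor K i.1.1 a * edgeSymbol K p i.2.1))
      fun i => Polynomial.C
        (minor K i.2.1 p * edgeSymbol K a i.1.1 - minor K i.1.1 p * edgeSymbol K a i.2.1))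

theorem EdgeSplit.reesSymbolHom_newRelation (s : EdgeSplit G G₁ G₂ C p a)
    (i : NewRelation G₁ G₂ p a) :
    reesSymbolHom K a p (newRelation K G₁ G₂ p a i) =
      Polynomial.C (newRelationLead K G₁ G₂ p a i) * Polynomial.X +
        Polynomial.C (newRelationTail K G₁ G₂ p a i) := by
  have hm : ∀ u v, symbolHom a p (minor K u v) = Polynomial.C (minor K u v) := fun u v =>
    symbolHom_of_mem_supported (minor_mem_supported_compl a p u v)
  rcases i with _ | i | i
  · simp only [newRelation, newRelationLead, newRelationTail, Sum.elim_inl, map_sub, map_mul,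
      reesSymbolHom_C, reesSymbolHom_X, hm, symbolHom_edgeSymbol s.ne, Polynomial.map_C,
      Polynomial.map_X, map_neg]
    ring
  · have hb : ∀ b : {b // G₁.Adj p b}, symbolHom a p (edgeSymbol K p b.1) =
        Polynomial.C (edgeSymbol K p b.1) := by
      intro b
      refine symbolHom_of_mem_supported (edgeSymbol_mem_supported_compl fun h => ?_)
      rcases Sym2.eq_iff.mp h with h | h
      · exact s.ne h.1.symm
      · exact s.notMem (h.2 ▸ (s.left _ _ b.2).2)
    have hpa : symbolHom a p (edgeSymbol K p a) = -Polynomial.X := by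
      rw [edgeSymbol_swap, map_neg, symbolHom_edgeSymbol s.ne]
    simp only [newRelation, newRelationLead, newRelationTail, Sum.elim_inl, Sum.elim_inr,
      reesSymbolHom_C, plucker, map_add, map_sub, map_mul, hm, hb, hpa, Polynomial.map_C,
      Polynomial.map_X, Polynomial.map_neg, map_neg]
    ring
  · simp only [newRelation, newRelationLead, newRelationTail, Sum.elim_inr, reesSymbolHom_C]
    have := symbolHom_edgePluckers (K := K) s i
    rw [edgePluckers] at this
    rw [this]
    simp only [Polynomial.map_add, Polynomial.map_mul, Polynomial.map_C, Polynomial.map_X]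

theorem EdgeSplit.reesIdeal_eq (s : EdgeSplit G G₁ G₂ C p a) :
    reesIdeal K G = reesIdeal K (G₁ ⊔ G₂) ⊔ Ideal.span (Set.range (newRelation K G₁ G₂ p a)) := by
  apply le_antisymm
  · set I := reesIdeal K (G₁ ⊔ G₂) ⊔ Ideal.span (Set.range (newRelation K G₁ G₂ p a)) with hI
    have h₀ : reesIdeal K (G₁ ⊔ G₂) ≤ I := le_sup_left
    have h₁ : reesIdeal K G₁ ≤ I := (reesIdeal_mono le_sup_left).trans h₀
    have h₂ : reesIdeal K G₂ ≤ I := (reesIdeal_mono le_sup_right).trans h₀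
    have hn : ∀ i, newRelation K G₁ G₂ p a i ∈ I := fun i =>
      Ideal.mem_sup_right (Ideal.subset_span ⟨i, rfl⟩)
    have hap : Polynomial.C (minor K a p) - Polynomial.X * Polynomial.C (edgeSymbol K a p) ∈ I :=
      hn (Sum.inl ())
    refine reesIdeal_le ?_ ?_
    · intro u v huv
      rcases (s.adj_iff _ _).mp huv with h | h | ⟨rfl, rfl⟩ | ⟨rfl, rfl⟩
      · exact h₁ (sub_mem_reesIdeal h)
      · exact h₂ (sub_mem_reesIdeal h)
      · have h := neg_mem hap
        rw [minor_swap, edgeSymbol_swap, Polynomial.C_neg, Polynomial.C_neg] at h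
        convert h using 1
        ring
      · exact hap
    · intro w b c d hb hc hd
      by_cases hwp : w = p
      · subst hwp
        rw [s.adj_root_iff] at hb hc hd
        exact plucker_mem_of_neighbors (I := I.comap Polynomial.C) (N := G₁.Adj w)
          (fun b c d hb hc hd => h₁ (plucker_mem_reesIdeal hb hc hd))
          (fun b c hb hc => hn (Sum.inr (Sum.inl (⟨b, hb⟩, ⟨c, hc⟩)))) hb hc hd
      by_cases hwa : w = a
      · subst hwa
        rw [s.adj_branch_iff] at hb hc hd
        exact plucker_mem_of_neighbors (I := I.comap Polynomial.C) (N := G₂.Adj w)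
          (fun b c d hb hc hd => h₂ (plucker_mem_reesIdeal hb hc hd))
          (fun b c hb hc => hn (Sum.inr (Sum.inr (⟨b, hb⟩, ⟨c, hc⟩)))) hb hc hd
      by_cases hw : w ∈ C
      · exact h₁ (plucker_mem_reesIdeal (s.adj_of_mem hw hwp hb) (s.adj_of_mem hw hwp hc)
          (s.adj_of_mem hw hwp hd))
      · exact h₂ (plucker_mem_reesIdeal (s.adj_of_notMem hw hwa hb) (s.adj_of_notMem hw hwa hc)
          (s.adj_of_notMem hw hwa hd))
  · refine sup_le (reesIdeal_mono (sup_le s.left_le s.right_le)) (Ideal.span_le.mpr ?_)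
    rintro _ ⟨_ | i | i, rfl⟩
    · exact sub_mem_reesIdeal s.adj.symm
    · exact plucker_mem_reesIdeal (s.left_le i.1.2) (s.left_le i.2.2) s.adj
    · exact plucker_mem_reesIdeal (s.right_le i.1.2) (s.right_le i.2.2) s.adj.symm

/-- Modulo the relations of `G₁ ⊔ G₂`, the value `minor K a p / X` of the symbol of the new edge
is a root of the new relations. -/
theorem newRelation_root (i : NewRelation G₁ G₂ p a) :
    Polynomial.X * newRelationTail K G₁ G₂ p a i +
      newRelationLead K G₁ G₂ p a i * Polynomial.C (minor K a p) ∈ reesIdeal K (G₁ ⊔ G₂) := by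
  have key : ∀ w z b c : V, (G₁ ⊔ G₂).Adj w b → (G₁ ⊔ G₂).Adj w c →
      Polynomial.X * Polynomial.C (minor K c z * edgeSymbol K w b - minor K b z * edgeSymbol K w c)
        + Polynomial.C (minor K b c) * Polynomial.C (minor K w z) ∈ reesIdeal K (G₁ ⊔ G₂) := by
    intro w z b c hb hc
    have h1 := Ideal.sub_mem _
      (Ideal.mul_mem_left _ (Polynomial.C (minor K b z)) (sub_mem_reesIdeal (K := K) hc))
      (Ideal.mul_mem_left _ (Polynomial.C (minor K c z)) (sub_mem_reesIdeal (K := K) hb))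
    have h2 : Polynomial.C (minor K b c) * Polynomial.C (minor K w z) =
        Polynomial.C (minor K b z) * Polynomial.C (minor K w c) -
          Polynomial.C (minor K c z) * Polynomial.C (minor K w b) := by
      rw [← Polynomial.C_mul, ← Polynomial.C_mul, ← Polynomial.C_mul, ← Polynomial.C_sub]
      congr 1
      simp only [minor]
      ring
    rw [h2]
    convert h1 using 1
    simp only [Polynomial.C_sub, Polynomial.C_mul]
    ring
  rcases i with _ | i | i
  · have : Polynomial.X * newRelationTail K G₁ G₂ p a (Sum.inl ()) +
        newRelationLead K G₁ G₂ p a (Sum.inl ()) * Polynomial.C (minor K a p) = 0 := by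
      simp only [newRelationTail, newRelationLead, Sum.elim_inl]; ring
    rw [this]
    exact Ideal.zero_mem _
  · have := key p a i.1.1 i.2.1 (Or.inl i.1.2) (Or.inl i.2.2)
    rwa [minor_swap a p, ← Polynomial.C_mul, ← neg_mul_comm, Polynomial.C_mul] at this
  · exact key a p i.1.1 i.2.1 (Or.inr i.1.2) (Or.inr i.2.2)

/-- Regularity of the Rees variable passes from `G₁ ⊔ G₂` to `G`: the symbol of the new edge is the
quotient of its minor by `X`. -/
theorem EdgeSplit.regularMod_reesIdeal [Finite V] (s : EdgeSplit G G₁ G₂ C p a)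
    (hR : RegularMod (reesIdeal K (G₁ ⊔ G₂)) Polynomial.X)
    (hN : RegularMod (markedIdeal K G₁ p) (xVar K p))
    (hN₂ : RegularMod (markedIdeal K G₂ a) (xVar K a)) :
    RegularMod (reesIdeal K G) Polynomial.X := by
  let _ : Fintype {b // G₁.Adj p b} := Fintype.ofFinite _
  let _ : Fintype {c // G₂.Adj a c} := Fintype.ofFinite _
  have hap : ¬ (G₁ ⊔ G₂).Adj a p := by
    rintro (h | h)
    · exact s.notMem (s.left _ _ h).1
    · exact (s.right _ _ h).2 s.mem
  have hXd : Polynomial.X ∈ Ideal.span (Set.range (newRelationLead K G₁ G₂ p a)) := by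
    have : -Polynomial.X ∈ Ideal.span (Set.range (newRelationLead K G₁ G₂ p a)) :=
      Ideal.subset_span ⟨Sum.inl (), rfl⟩
    simpa using neg_mem this
  rw [s.reesIdeal_eq]
  refine regularMod_of_linearIdeal (reesSymbolHom K a p) (Polynomial.C (edgeSymbol K a p))
    eval_reesSymbolHom (reesSymbolHom_mem hap) reesSymbolHom_X s.reesSymbolHom_newRelation
    (regularMod_linearIdeal_of_root hR newRelation_root hXd ?_)
  -- Modulo `X` this is the regularity of the minor modulo the marked ideals.
  set I := reesIdeal K (G₁ ⊔ G₂) ⊔ Ideal.span (Set.range (newRelationLead K G₁ G₂ p a)) with hI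
  have hX : Polynomial.X ∈ I := Ideal.mem_sup_right hXd
  have hd : ∀ i, newRelationLead K G₁ G₂ p a i ∈ I := fun i =>
    Ideal.mem_sup_right (Ideal.subset_span ⟨i, rfl⟩)
  have h₁ : markedIdeal K G₁ p ⊔ markedIdeal K G₂ a ≤ I.comap Polynomial.C := by
    refine sup_le (sup_le ?_ (cliqueIdeal_le ?_)) (sup_le ?_ (cliqueIdeal_le ?_))
    · exact fun f hf => C_mem_of_mem_gradedIdeal (G := G₁)
        ((reesIdeal_mono le_sup_left).trans le_sup_left) hX hf
    · intro b c hb hc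
      have := neg_mem (hd (Sum.inr (Sum.inl (⟨b, hb⟩, ⟨c, hc⟩))))
      simpa [newRelationLead] using this
    · exact fun f hf => C_mem_of_mem_gradedIdeal (G := G₂)
        ((reesIdeal_mono le_sup_right).trans le_sup_left) hX hf
    · intro b c hb hc
      exact hd (Sum.inr (Sum.inr (⟨b, hb⟩, ⟨c, hc⟩)))
  have h₂ : I ≤ (markedIdeal K G₁ p ⊔ markedIdeal K G₂ a).comap (Polynomial.evalRingHom 0) := by
    refine sup_le (reesIdeal_le ?_ ?_) (Ideal.span_le.mpr ?_)
    · rintro u v (huv | huv)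
      · have : minor K u v ∈ markedIdeal K G₁ p ⊔ markedIdeal K G₂ a :=
          Ideal.mem_sup_left (Ideal.mem_sup_left (minor_mem_gradedIdeal huv))
        simpa using this
      · have : minor K u v ∈ markedIdeal K G₁ p ⊔ markedIdeal K G₂ a :=
          Ideal.mem_sup_right (Ideal.mem_sup_left (minor_mem_gradedIdeal huv))
        simpa using this
    · intro w b c d hb hc hd
      have : plucker K w b c d ∈ gradedIdeal K G₁ ⊔ gradedIdeal K G₂ := by
        by_cases hw : w ∈ C
        · have h : ∀ v, (G₁ ⊔ G₂).Adj w v → G₁.Adj w v := fun v hv =>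
            hv.resolve_right fun h => (s.right _ _ h).1 hw
          exact Ideal.mem_sup_left (plucker_mem_gradedIdeal (h _ hb) (h _ hc) (h _ hd))
        · have h : ∀ v, (G₁ ⊔ G₂).Adj w v → G₂.Adj w v := fun v hv =>
            hv.resolve_left fun h => hw (s.left _ _ h).1
          exact Ideal.mem_sup_right (plucker_mem_gradedIdeal (h _ hb) (h _ hc) (h _ hd))
      have : plucker K w b c d ∈ markedIdeal K G₁ p ⊔ markedIdeal K G₂ a :=
        (sup_le_sup le_sup_left le_sup_left :
          gradedIdeal K G₁ ⊔ gradedIdeal K G₂ ≤ markedIdeal K G₁ p ⊔ markedIdeal K G₂ a) this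
      simpa using this
    · rintro _ ⟨_ | i | i, rfl⟩
      · simp [newRelationLead]
      · have : minor K i.1.1 i.2.1 ∈ markedIdeal K G₁ p ⊔ markedIdeal K G₂ a :=
          Ideal.mem_sup_left (Ideal.mem_sup_right (minor_mem_cliqueIdeal i.1.2 i.2.2))
        simpa [newRelationLead] using this
      · have : minor K i.1.1 i.2.1 ∈ markedIdeal K G₁ p ⊔ markedIdeal K G₂ a :=
          Ideal.mem_sup_right (Ideal.mem_sup_right (minor_mem_cliqueIdeal i.1.2 i.2.2))
        simpa [newRelationLead] using this
  intro f hf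
  have h₃ : f.eval 0 ∈ markedIdeal K G₁ p ⊔ markedIdeal K G₂ a := by
    refine s.regularMod_minor hN hN₂ _ ?_
    have := h₂ hf
    simpa using this
  obtain ⟨k, hk⟩ : Polynomial.X ∣ f - Polynomial.C (f.eval 0) := by
    rw [← Polynomial.coeff_zero_eq_eval_zero]; exact Polynomial.X_dvd_sub_C
  have h₄ : f = Polynomial.X * k + Polynomial.C (f.eval 0) := eq_add_of_sub_eq hk
  rw [h₄]
  exact Ideal.add_mem _ (Ideal.mul_mem_right _ _ hX) (h₁ h₃)

/-- The regularity statements for forests, by induction on the graph. -/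
theorem regularMod_of_isAcyclic (K : Type*) [Field K] [Finite V] (G : SimpleGraph V)
    (hG : G.IsAcyclic) :
    (∀ p, RegularMod (markedIdeal K G p) (xVar K p) ∧
      RegularMod (markedIdeal K G p ⊔ yIdeal K G p) (xVar K p)) ∧
    RegularMod (reesIdeal K G) Polynomial.X := by
  induction G using WellFoundedLT.induction with
  | _ G ih =>
    constructor
    · intro p
      by_cases hp : ∃ a, G.Adj p a
      · obtain ⟨a, ha⟩ := hp
        obtain ⟨G₁, G₂, C, s, hlt⟩ := exists_edgeSplit hG ha
        have h₁ := (ih G₁ (le_sup_left.trans_lt hlt) (hG.anti s.left_le)).1 p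
        have h₂ := ih G₂ (le_sup_right.trans_lt hlt) (hG.anti s.right_le)
        have hS : HasColumnSyzygies K G₂ a := hasColumnSyzygies_of_regularMod h₂.2 a
        exact ⟨s.regularMod_markedIdeal h₁.1 h₁.2 (h₂.1 a).1 hS,
          s.regularMod_markedIdeal_sup_yIdeal h₁.2 (h₂.1 a).1 hS⟩
      · exact regularMod_of_isolated (not_exists.mp hp)
    · by_cases hp : ∃ p a, G.Adj p a
      · obtain ⟨p, a, ha⟩ := hp
        obtain ⟨G₁, G₂, C, s, hlt⟩ := exists_edgeSplit hG ha
        have h₁ := ih G₁ (le_sup_left.trans_lt hlt) (hG.anti s.left_le)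
        have h₂ := ih G₂ (le_sup_right.trans_lt hlt) (hG.anti s.right_le)
        have h₀ := ih (G₁ ⊔ G₂) hlt (hG.anti hlt.le)
        exact s.regularMod_reesIdeal h₀.2 (h₁.1 p).1 (h₂.1 a).1
      · have h0 : reesIdeal K G = ⊥ := by
          refine le_bot_iff.mp (reesIdeal_le ?_ ?_)
          · exact fun u v huv => absurd ⟨u, v, huv⟩ hp
          · exact fun w b _ _ hb => absurd ⟨w, b, hb⟩ hp
        rw [h0]
        intro f hf
        exact (mul_eq_zero.mp hf).resolve_left Polynomial.X_ne_zero

end Rees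

/-! ### Linear relations and contraction -/

section Contraction

open MvPolynomial

variable {A : Type*} [CommRing A] {n : ℕ}

theorem mem_relationIdeal_one {z : Fin n → A} {F : MvPolynomial (Fin n) A}
    (hF : F.IsHomogeneous 1) (h0 : eval z F = 0) : F ∈ relationIdeal z 1 :=
  Ideal.subset_span ⟨1, le_rfl, one_pos, hF, h0⟩

theorem isLinearType_of_relation_mem {z : Fin n → A}
    (h : ∀ d F, IsRelation z d F → F ∈ relationIdeal z 1) : IsLinearType z := by
  have hle : ∀ j, relationIdeal z j ≤ relationIdeal z 1 := fun j => by
    rw [relationIdeal, Ideal.span_le]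
    rintro F ⟨d, -, hF⟩
    exact h d F hF
  have hmem : 1 ∈ {r : ℕ | 0 < r ∧
      (relationIdeal z r : Set (MvPolynomial (Fin n) A)) = ⋃ j ≥ r, relationIdeal z j} := by
    refine ⟨one_pos, Set.Subset.antisymm ?_ ?_⟩
    · exact fun F hF => Set.mem_iUnion₂.mpr ⟨1, le_rfl, hF⟩
    · intro F hF
      obtain ⟨j, -, hj⟩ := Set.mem_iUnion₂.mp hF
      exact hle j hj
  exact le_antisymm (Nat.sInf_le hmem) (Nat.sInf_mem ⟨1, hmem⟩).1

theorem eq_sum_of_isHomogeneous_one {F : MvPolynomial (Fin n) A} (hF : F.IsHomogeneous 1) :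
    ∃ c : Fin n → A, F = ∑ k, C (c k) * X k := by
  have h := (mem_homogeneousSubmodule 1 F).mpr hF
  rw [homogeneousSubmodule_one_eq_span_X, Submodule.mem_span_range_iff_exists_fun] at h
  obtain ⟨c, rfl⟩ := h
  exact ⟨c, Finset.sum_congr rfl fun k _ => by rw [smul_eq_C_mul]⟩

/-- In each nonconstant monomial, replace one of the variables `X k` by its value `z k`. The choice
of the variable does not matter modulo the linear relations on `z`. -/
noncomputable def contraction (z : Fin n → A) :
    MvPolynomial (Fin n) A →ₗ[A] MvPolynomial (Fin n) A :=
  open scoped Classical in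
  (basisMonomials (Fin n) A).constr A fun s =>
    if h : s.support.Nonempty then monomial (s - Finsupp.single h.choose 1) (z h.choose) else 0

theorem koszul_mem_relationIdeal (z : Fin n → A) (k l : Fin n) :
    C (z k) * X l - C (z l) * X k ∈ relationIdeal z 1 :=
  mem_relationIdeal_one ((isHomogeneous_C_mul_X (z k) l).sub (isHomogeneous_C_mul_X (z l) k))
    (by rw [map_sub, map_mul, map_mul, eval_C, eval_C, eval_X, eval_X, mul_comm, sub_self])

theorem contraction_X_mul (z : Fin n → A) (k : Fin n) (g : MvPolynomial (Fin n) A) :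
    contraction z (X k * g) - C (z k) * g ∈ relationIdeal z 1 := by
  refine MvPolynomial.induction_on' (P := fun g =>
    contraction z (X k * g) - C (z k) * g ∈ relationIdeal z 1) g
    (fun s c => ?_) (fun g h hg hh => ?_)
  rotate_left
  · rw [mul_add, map_add, mul_add]
    convert Ideal.add_mem _ hg hh using 1
    ring
  · have hX : (X k : MvPolynomial (Fin n) A) * monomial s c =
        c • basisMonomials (Fin n) A (s + Finsupp.single k 1) := by
      rw [coe_basisMonomials, smul_monomial, smul_eq_mul, mul_one, X, monomial_mul, one_mul,
        add_comm]
    have hne : (s + Finsupp.single k 1).support.Nonempty := ⟨k, by simp⟩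
    rw [hX, map_smul, contraction, Module.Basis.constr_basis, dif_pos hne]
    have hlmem := hne.choose_spec
    generalize hne.choose = l at hlmem ⊢
    clear hne hX
    by_cases hlk : l = k
    · rw [hlk, add_tsub_cancel_right, smul_monomial, C_mul_monomial, smul_eq_mul, mul_comm,
        sub_self]
      exact Ideal.zero_mem _
    · have hls : s l ≠ 0 := by
        simpa [Finsupp.single_apply, Ne.symm hlk] using hlmem
      obtain ⟨t, rfl⟩ : ∃ t, s = t + Finsupp.single l 1 :=
        ⟨s - Finsupp.single l 1, (tsub_add_cancel_of_le (Finsupp.single_le_iff.mpr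
          (Nat.one_le_iff_ne_zero.mpr hls))).symm⟩
      have h1 : t + Finsupp.single l 1 + Finsupp.single k 1 - Finsupp.single l 1 =
          t + Finsupp.single k 1 := by
        rw [add_right_comm, add_tsub_cancel_right]
      have h2 : c • monomial (t + Finsupp.single k 1) (z l) -
          C (z k) * monomial (t + Finsupp.single l 1) c =
          monomial t c * (C (z l) * X k - C (z k) * X l) := by
        rw [mul_sub, C_mul_X_eq_monomial, C_mul_X_eq_monomial, monomial_mul, monomial_mul,
          C_mul_monomial, smul_monomial, smul_eq_mul, mul_comm (z k)]
      rw [h1, h2]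
      exact Ideal.mul_mem_left _ _ (koszul_mem_relationIdeal z l k)

theorem contraction_mem (z : Fin n → A) {F : MvPolynomial (Fin n) A}
    (hF : F ∈ relationIdeal z 1) : contraction z F ∈ relationIdeal z 1 := by
  suffices H : ∀ g, contraction z (g * F) ∈ relationIdeal z 1 by simpa using H 1
  refine Submodule.span_induction (p := fun F _ => ∀ g, contraction z (g * F) ∈ relationIdeal z 1)
    ?_ ?_ ?_ ?_ hF
  · rintro F ⟨d, hd, hd0, hF, h0⟩ g
    obtain rfl : d = 1 := by omega
    obtain ⟨c, rfl⟩ := eq_sum_of_isHomogeneous_one hF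
    have h1 : contraction z (g * ∑ k, C (c k) * X k) =
        ∑ k, c k • (contraction z (X k * g) - C (z k) * g) := by
      have h2 : ∑ k, c k • (C (z k) * g) = 0 := by
        have h3 : ∑ k, c k * z k = 0 := by simpa using h0
        have h4 : ∑ k, c k • (C (z k) * g) = C (∑ k, c k * z k) * g := by
          rw [map_sum, Finset.sum_mul]
          refine Finset.sum_congr rfl fun k _ => ?_
          rw [smul_eq_C_mul, C_mul, mul_assoc]
        rw [h4, h3, C_0, zero_mul]
      simp only [smul_sub, Finset.sum_sub_distrib, h2, sub_zero]
      rw [Finset.mul_sum, map_sum]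
      refine Finset.sum_congr rfl fun k _ => ?_
      rw [← map_smul, smul_eq_C_mul]
      congr 1
      ring
    rw [h1]
    refine Ideal.sum_mem _ fun k _ => ?_
    rw [smul_eq_C_mul]
    exact Ideal.mul_mem_left _ _ (contraction_X_mul z k g)
  · intro g
    rw [mul_zero, map_zero]; exact Ideal.zero_mem _
  · intro F F' _ _ hF hF' g
    rw [mul_add, map_add]
    exact Ideal.add_mem _ (hF g) (hF' g)
  · intro r F _ hF g
    rw [smul_eq_mul, ← mul_assoc]
    exact hF _

/-- A polynomial that becomes a consequence of the linear relations once an extra variable `T` with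
`z k = T * X k` is adjoined already is one: comparing coefficients of powers of `T` leads to
identities `∑ k, g k * X k ≡ 0`, and contracting these gives `∑ k, g k * z k ≡ 0`. -/
theorem mem_relationIdeal_of_C_mem {z : Fin n → A} {F : MvPolynomial (Fin n) A}
    (hF : Polynomial.C F ∈ (relationIdeal z 1).map Polynomial.C ⊔
      Ideal.span (Set.range fun k : Fin n =>
        Polynomial.C (C (z k)) - Polynomial.X * Polynomial.C (X k))) :
    F ∈ relationIdeal z 1 := by
  obtain ⟨g, hg⟩ := exists_sum_of_mem_sup_span hF
  have hcoeff := Ideal.mem_map_C_iff.mp hg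
  have h0 : F - ∑ k, (g k).coeff 0 * C (z k) ∈ relationIdeal z 1 := by
    have := hcoeff 0
    simpa [Polynomial.finsetSum_coeff, mul_sub, ← mul_assoc, Polynomial.mul_coeff_zero] using this
  have hs : ∀ j, ∑ k, ((g k).coeff (j + 1) * C (z k) - (g k).coeff j * X k) ∈
      relationIdeal z 1 := by
    intro j
    have h1 := neg_mem (hcoeff (j + 1))
    rw [Polynomial.coeff_sub, Polynomial.coeff_C_of_ne_zero (Nat.succ_ne_zero j), zero_sub, neg_neg,
      Polynomial.finsetSum_coeff] at h1
    convert h1 using 2 with k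
    rw [mul_sub, Polynomial.coeff_sub, Polynomial.coeff_mul_C, ← mul_assoc, Polynomial.coeff_mul_C,
      Polynomial.coeff_mul_X]
  obtain ⟨N, hN⟩ := exists_coeff_bound g
  have key : ∀ m j, N ≤ j + m → ∑ k, (g k).coeff j * C (z k) ∈ relationIdeal z 1 := by
    intro m
    induction m with
    | zero =>
      intro j hj
      rw [Finset.sum_eq_zero fun k _ => by rw [hN k j hj, zero_mul]]
      exact Ideal.zero_mem _
    | succ m ih =>
      intro j hj
      have h1 := Ideal.sub_mem _ (ih (j + 1) (by omega)) (hs j)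
      rw [← Finset.sum_sub_distrib] at h1
      simp only [sub_sub_cancel] at h1
      have h2 := contraction_mem z h1
      rw [map_sum] at h2
      have h3 : ∑ k, (contraction z (X k * (g k).coeff j) - C (z k) * (g k).coeff j) ∈
          relationIdeal z 1 := Ideal.sum_mem _ fun k _ => contraction_X_mul z k _
      have h4 := Ideal.sub_mem _ h2 h3
      rw [← Finset.sum_sub_distrib] at h4
      convert h4 using 2 with k
      rw [mul_comm (X k), sub_sub_cancel, mul_comm]
  have := Ideal.add_mem _ h0 (key N 0 (by omega))
  rwa [sub_add_cancel] at this

end Contraction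

/-! ### Ideals of linear type -/

section Forest

open MvPolynomial

theorem pow_mul_eval₂_eq_zero {A B : Type*} [CommRing A] [CommRing B] {m d : ℕ}
    {F : MvPolynomial (Fin m) A} (hF : F.IsHomogeneous d) {f : Fin m → A} (h0 : eval f F = 0)
    {g : A →+* B} {t : B} {τ : Fin m → B} (h : ∀ k, t * τ k = g (f k)) :
    t ^ d * eval₂ g τ F = 0 := by
  have h1 : eval₂ g (fun k => t * τ k) F = t ^ d * eval₂ g τ F := by
    rw [eval₂_eq', eval₂_eq', Finset.mul_sum]
    refine Finset.sum_congr rfl fun s hs => ?_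
    have hd : ∑ k, s k = d := (Finsupp.degree_eq_sum s).symm.trans
      ((DFunLike.congr_fun Finsupp.degree_eq_weight_one s).trans (hF (mem_support_iff.mp hs)))
    simp only [mul_pow, Finset.prod_mul_distrib, Finset.prod_pow_eq_pow_sum, hd]
    ring
  rw [← h1, funext h]
  exact (hom_eval₂ F (RingHom.id A) g f).symm.trans ((congrArg g h0).trans (map_zero g))

theorem pow_mul_eval₂_mem {A B : Type*} [CommRing A] [CommRing B] {m d : ℕ}
    {F : MvPolynomial (Fin m) A} (hF : F.IsHomogeneous d) {f : Fin m → A} (h0 : eval f F = 0)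
    {g : A →+* B} {t : B} {τ : Fin m → B} {J : Ideal B} (h : ∀ k, g (f k) - t * τ k ∈ J) :
    t ^ d * eval₂ g τ F ∈ J := by
  rw [← Ideal.Quotient.eq_zero_iff_mem, map_mul, map_pow, hom_eval₂]
  refine pow_mul_eval₂_eq_zero hF h0 fun k => ?_
  rw [← map_mul]
  exact ((Ideal.Quotient.mk_eq_mk_iff_sub_mem _ _).mpr (h k)).symm

variable (K : Type*) [Field K] {V : Type*} [LinearOrder V] {m : ℕ}

/-- Substitution of the edge symbols for the variables of the presentation `S[X_1, …, X_m]` of the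
Rees algebra. -/
noncomputable def symbolSubst (e : Fin m → Sym2 V) :
    MvPolynomial (Fin m) (MvPolynomial (V ⊕ V) K) →+* MvPolynomial (TreeVar V) K :=
  eval₂Hom (rename (Sum.map id Sum.inl)).toRingHom fun k => edgeSymbol K (e k).inf (e k).sup

open scoped Classical in
/-- The left inverse of `symbolSubst`: the variable of a pair `(u, v)` goes to the variable of the
edge `uv` if `u < v` and that edge is listed, and to `0` otherwise. -/
noncomputable def symbolRetract (e : Fin m → Sym2 V) :
    MvPolynomial (TreeVar V) K →ₐ[K] MvPolynomial (Fin m) (MvPolynomial (V ⊕ V) K) :=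
  aeval (Sum.elim (fun v => C (X (Sum.inl v))) (Sum.elim (fun v => C (X (Sum.inr v)))
    fun q => if h : (∃ k, e k = s(q.1, q.2)) ∧ q.1 < q.2 then X h.1.choose else 0))

variable {K} {e : Fin m → Sym2 V} {G : SimpleGraph V}

theorem mk_inf_sup (z : Sym2 V) : s(z.inf, z.sup) = z := Sym2.sortEquiv.left_inv z

theorem rename_edgeBinomial (z : Sym2 V) :
    rename (Sum.map id Sum.inl) (edgeBinomial K z) = minor K z.inf z.sup := by
  simp [edgeBinomial, minor, xVar, yVar]

/-- In the extended Rees algebra the edge symbols are the edge binomials divided by `X`, so `X ^ d`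
kills the image of a relation of degree `d`. -/
theorem pow_mul_symbolSubst_mem (he : ∀ k, e k ∈ G.edgeSet) {d : ℕ}
    {F : MvPolynomial (Fin m) (MvPolynomial (V ⊕ V) K)} (hF : F.IsHomogeneous d)
    (h0 : eval (fun k => edgeBinomial K (e k)) F = 0) :
    Polynomial.X ^ d * Polynomial.C (symbolSubst K e F) ∈ reesIdeal K G := by
  have h1 : Polynomial.C (symbolSubst K e F) = _ :=
    hom_eval₂ (S₂ := Polynomial (MvPolynomial (TreeVar V) K)) F
      (rename (Sum.map id Sum.inl)).toRingHom Polynomial.C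
      fun k => edgeSymbol K (e k).inf (e k).sup
  rw [h1]
  refine pow_mul_eval₂_mem hF h0 fun k => ?_
  have hadj := he k
  rw [← mk_inf_sup (e k), SimpleGraph.mem_edgeSet] at hadj
  have h2 := sub_mem_reesIdeal (K := K) hadj
  rwa [← rename_edgeBinomial] at h2

theorem symbolRetract_minor (u v : V) : symbolRetract K e (minor K u v) =
    C (X (Sum.inl u) * X (Sum.inr v) - X (Sum.inl v) * X (Sum.inr u)) := by
  simp [symbolRetract, minor, xVar, yVar]

theorem symbolRetract_edgeSymbol (he : Function.Injective e) {u v : V} (huv : u < v) {k : Fin m}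
    (hk : e k = s(u, v)) : symbolRetract K e (edgeSymbol K u v) = X k := by
  classical
  have h : (∃ k, e k = s(u, v)) ∧ u < v := ⟨⟨k, hk⟩, huv⟩
  have h1 : symbolRetract K e (X (Sum.inr (Sum.inr (u, v)))) = X h.1.choose := by
    rw [symbolRetract, aeval_X]
    exact dif_pos h
  have h2 : symbolRetract K e (X (Sum.inr (Sum.inr (v, u)))) = 0 := by
    rw [symbolRetract, aeval_X]
    exact dif_neg fun h => huv.asymm h.2
  rw [edgeSymbol, map_sub, h1, h2, sub_zero, he (h.1.choose_spec.trans hk.symm)]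

theorem inf_lt_sup (he : ∀ k, e k ∈ G.edgeSet) (k : Fin m) : (e k).inf < (e k).sup := by
  have := he k
  rw [← mk_inf_sup (e k), SimpleGraph.mem_edgeSet] at this
  exact (Sym2.inf_le_sup _).lt_of_ne this.ne

theorem symbolRetract_symbolSubst (he : ∀ k, e k ∈ G.edgeSet) (hinj : Function.Injective e)
    (F : MvPolynomial (Fin m) (MvPolynomial (V ⊕ V) K)) :
    symbolRetract K e (symbolSubst K e F) = F := by
  have : (symbolRetract K e).toRingHom.comp (symbolSubst K e) = RingHom.id _ := by
    refine MvPolynomial.ringHom_ext (fun f => ?_) fun k => ?_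
    · have : ((symbolRetract K e).comp (rename (Sum.map id Sum.inl))) =
          IsScalarTower.toAlgHom K (MvPolynomial (V ⊕ V) K) _ := by
        refine MvPolynomial.algHom_ext fun v => ?_
        rcases v with v | v <;> simp [symbolRetract, algebraMap_eq]
      have := DFunLike.congr_fun this f
      simpa [symbolSubst, algebraMap_eq] using this
    · have := symbolRetract_edgeSymbol (K := K) hinj (inf_lt_sup he k) (mk_inf_sup _).symm
      simpa [symbolSubst] using this
  exact DFunLike.congr_fun this F

/-- The symbol of an edge goes to the variable of that edge, up to a sign that is also the sign by
which the minor differs from the edge binomial. -/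
theorem exists_symbolRetract_edgeSymbol (hinj : Function.Injective e) {u v : V} (huv : u ≠ v)
    {k : Fin m} (hk : e k = s(u, v)) : ∃ c : MvPolynomial (V ⊕ V) K,
      symbolRetract K e (edgeSymbol K u v) = C c * X k ∧
      X (Sum.inl u) * X (Sum.inr v) - X (Sum.inl v) * X (Sum.inr u) =
        c * edgeBinomial K (e k) := by
  rcases lt_or_gt_of_ne huv with h | h
  · refine ⟨1, ?_, ?_⟩
    · rw [symbolRetract_edgeSymbol hinj h hk, C_1, one_mul]
    · simp [edgeBinomial, hk, h.le]
  · refine ⟨-1, ?_, ?_⟩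
    · rw [edgeSymbol_swap, map_neg, symbolRetract_edgeSymbol hinj h (hk.trans Sym2.eq_swap), C_neg,
        C_1]
      exact (neg_one_mul (X k : MvPolynomial (Fin m) (MvPolynomial (V ⊕ V) K))).symm
    · simp [edgeBinomial, hk, h.le]

theorem symbolRetract_plucker_mem (hinj : Function.Injective e)
    (hE : ∀ u v, G.Adj u v → ∃ k, e k = s(u, v)) {w a b c : V} (ha : G.Adj w a)
    (hb : G.Adj w b) (hc : G.Adj w c) :
    symbolRetract K e (plucker K w a b c) ∈
      relationIdeal (fun k => edgeBinomial K (e k)) 1 := by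
  have key : ∀ v, G.Adj w v → (symbolRetract K e (edgeSymbol K w v)).IsHomogeneous 1 ∧
      eval (fun k => edgeBinomial K (e k)) (symbolRetract K e (edgeSymbol K w v)) =
        X (Sum.inl w) * X (Sum.inr v) - X (Sum.inl v) * X (Sum.inr w) := by
    intro v hv
    obtain ⟨k, hk⟩ := hE w v hv
    obtain ⟨c, h1, h2⟩ := exists_symbolRetract_edgeSymbol (K := K) hinj hv.ne hk
    rw [h1, h2, map_mul, eval_C, eval_X]
    exact ⟨isHomogeneous_C_mul_X c k, rfl⟩
  rw [plucker, map_add, map_sub, map_mul, map_mul, map_mul, symbolRetract_minor,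
    symbolRetract_minor, symbolRetract_minor]
  refine mem_relationIdeal_one
    ((((key c hc).1.C_mul _).sub ((key b hb).1.C_mul _)).add ((key a ha).1.C_mul _)) ?_
  rw [map_add, map_sub, map_mul, map_mul, map_mul, eval_C, eval_C, eval_C, (key a ha).2,
    (key b hb).2, (key c hc).2]
  ring

/-- The edge binomials of a forest form a sequence that generates an ideal of linear type. -/
theorem isLinearType_edgeBinomial [Finite V] (hG : G.IsAcyclic) (he : ∀ k, e k ∈ G.edgeSet)
    (hinj : Function.Injective e) (hE : ∀ u v, G.Adj u v → ∃ k, e k = s(u, v)) :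
    IsLinearType fun k => edgeBinomial K (e k) := by
  -- A relation vanishes in the extended Rees algebra, where the Rees variable is regular. Its
  -- image in the symmetric algebra with the Rees variable adjoined involves linear relations
  -- only.
  refine isLinearType_of_relation_mem fun d F hF => mem_relationIdeal_of_C_mem ?_
  obtain ⟨-, hd, h0⟩ := hF
  have h1 : Polynomial.C (symbolSubst K e F) ∈ reesIdeal K G :=
    ((regularMod_of_isAcyclic K G hG).2.pow d) _ (pow_mul_symbolSubst_mem he hd h0)
  set f : Fin m → MvPolynomial (V ⊕ V) K := fun k => edgeBinomial K (e k) with hf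
  set J : Ideal (Polynomial (MvPolynomial (Fin m) (MvPolynomial (V ⊕ V) K))) :=
    (relationIdeal f 1).map Polynomial.C ⊔ Ideal.span (Set.range fun k : Fin m =>
      Polynomial.C (C (f k)) - Polynomial.X * Polynomial.C (X k)) with hJ
  have h2 : reesIdeal K G ≤ J.comap (Polynomial.mapRingHom (symbolRetract K e).toRingHom) := by
    refine reesIdeal_le ?_ ?_
    · intro u v huv
      obtain ⟨k, hk⟩ := hE u v huv
      obtain ⟨c, h3, h4⟩ := exists_symbolRetract_edgeSymbol (K := K) hinj huv.ne hk
      have h5 : Polynomial.mapRingHom (symbolRetract K e).toRingHom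
          (Polynomial.C (minor K u v) - Polynomial.X * Polynomial.C (edgeSymbol K u v)) =
          Polynomial.C (C c) * (Polynomial.C (C (f k)) - Polynomial.X * Polynomial.C (X k)) := by
        have h6 : Polynomial.mapRingHom (symbolRetract K e).toRingHom
          (Polynomial.C (minor K u v) - Polynomial.X * Polynomial.C (edgeSymbol K u v)) =
          Polynomial.C (symbolRetract K e (minor K u v)) -
            Polynomial.X * Polynomial.C (symbolRetract K e (edgeSymbol K u v)) := by
          simp
        rw [h6, symbolRetract_minor, h3, h4, C_mul, Polynomial.C_mul, Polynomial.C_mul]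
        ring
      rw [Ideal.mem_comap, h5]
      exact Ideal.mul_mem_left _ _ (Ideal.mem_sup_right (Ideal.subset_span ⟨k, rfl⟩))
    · intro w a b c ha hb hc
      rw [Ideal.mem_comap, Polynomial.coe_mapRingHom, Polynomial.map_C]
      exact Ideal.mem_sup_left (Ideal.mem_map_of_mem _ (symbolRetract_plucker_mem hinj hE ha hb hc))
  have h3 := h2 h1
  rw [Ideal.mem_comap, Polynomial.coe_mapRingHom, Polynomial.map_C] at h3
  convert h3 using 2
  exact (symbolRetract_symbolSubst he hinj F).symm

end Forest

end BinomialEdge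

theorem mainTheorem5 (K : Type*) [Field K] (n : ℕ) (G : SimpleGraph (Fin (n + 1)))
    (hG : G.IsTree) (r : Fin (n + 1)) (hr : BinomialEdge.IsPendant G r)
    (e : Fin n ≃ G.edgeSet)
    (he : Monotone fun i : Fin n => BinomialEdge.edgeLevel G r (e i : Sym2 (Fin (n + 1)))) :
    BinomialEdge.IsSequenceOfLinearType
      fun i : Fin n => BinomialEdge.edgeBinomial K (e i : Sym2 (Fin (n + 1))) := by
  intro i hi _
  -- The first `i` edges span a forest.
  have hsub : Set.range (fun k : Fin i => (e (Fin.castLE hi k) : Sym2 (Fin (n + 1)))) ⊆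
      G.edgeSet := by
    rintro _ ⟨k, rfl⟩
    exact (e _).2
  have hedge : (SimpleGraph.fromEdgeSet (Set.range fun k : Fin i =>
      (e (Fin.castLE hi k) : Sym2 (Fin (n + 1))))).edgeSet = Set.range fun k : Fin i =>
      (e (Fin.castLE hi k) : Sym2 (Fin (n + 1))) := by
    rw [SimpleGraph.edgeSet_fromEdgeSet]
    exact sdiff_eq_left.mpr (Set.disjoint_left.mpr fun z hz hd =>
      G.not_isDiag_of_mem_edgeSet (hsub hz) hd)
  refine BinomialEdge.isLinearType_edgeBinomial (K := K)
    (hG.isAcyclic.anti (SimpleGraph.edgeSet_subset_edgeSet.mp (hedge.trans_subset hsub)))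
    (fun k => ?_) ?_ fun u v huv => ?_
  · rw [hedge]
    exact ⟨k, rfl⟩
  · exact Subtype.val_injective.comp (e.injective.comp (Fin.castLE_injective hi))
  · rwa [← SimpleGraph.mem_edgeSet, hedge] at huv
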